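/- Let $E/\mathbb{Q}$ be a finite extension with finite group $G=\mathrm{Gal}(E/\mathbb{Q})$ (the group of automorphisms of $E$; in practice $E/\mathbb Q$ is Galois). Sums over $\rho$ or $\gamma$ run over the finitely many isomorphism classes of irreducible complex representations of $G$. Let $R(G)$ be the ring of complex linear combinations, and $R(G,\mathbb{Z})$ the subset of integer linear combinations, of the irreducible characters of $G$, and let $\langle\sigma,\rho\rangle=\frac1{|G|}\sum_{g\in G}\mathrm{tr}\,\sigma(g)\,\mathrm{tr}\,\rho(g^{-1})$, the multiplicity of the irreducible representation $\rho$ in $\sigma$. For a representation $V$ of $G$, a positive integer $d$ and a primitive $d$-th root of unity $\zeta$, the cyclic tensor power $V^{\otimes_{\rm cyc}d}$ is the quotient of $V^{\otimes d}$ by the span of all $\zeta^m v-m.v$, where $m\in\mathbb{Z}/d$ acts by $m.(a_1\otimes\cdots\otimes a_d)=a_{1+m}\otimes\cdots\otimes a_{d+m}$ (indices mod $d$), with the induced action of $G$. Any choice of $\zeta$ is allowed, for each $d$. Let $Q\in 1+zR(G)[[z]]$, and for $g\in G$ let $Q_g(z)\in 1+z\mathbb{C}[[z]]$ be obtained by evaluating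 the coefficients of $Q$ at $g$; for a prime $p$ unramified in $E$ with Frobenius element $\mathrm{Fr}_p$ put $Q_p=Q_{\mathrm{Fr}_p}$. Infinite sums of power series converge $z$-adically. Then there are unique families of complex numbers $q_{n,\rho}$ and $b_{n,\rho}$ ($n\ge1$) such that, for all $g\in G$ (that is, as identities in $R(G)[[z]]$), $$\log Q_g(z)=\sum_{n\ge1}\sum_\rho q_{n,\rho}\,\mathrm{tr}\,\rho(g)\,z^n,\qquad \log Q_g(z)=-\sum_{n\ge1}\sum_\rho b_{n,\rho}\log\det\bigl(I-\rho(g)z^n\bigr);$$ in particular these hold for $Q_p$ with $g=\mathrm{Fr}_p$ at every prime $p$ unramified in $E$. Moreover: (i) Define $r_{n,\rho}$ recursively by $r_{1,\rho}=q_{1,\rho}$ and $$r_{n,\rho}=q_{n,\rho}-\sum_{\substack{d\mid n\\ d>1}}\sum_{\gamma}\frac{\langle\gamma^{\otimes d},\rho\rangle}{d}\,r_{n/d,\gamma}.$$ Then for all $n\ge1$ and all $\rho$, $$b_{n,\rho}=\sum_{d\mid n}\sum_{\gamma}\langle\gamma^{\otimes_{\rm cyc}d},\rho\rangle\,r_{n/d,\gamma}.$$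 (ii) If $Q\in 1+zR(G,\mathbb{Z})[[z]]$, then $b_{n,\rho}\in\mathbb{Z}$ for all $n\ge 1$ and all $\rho$. -/

import Mathlib

open scoped PowerSeries NumberField

noncomputable section

namespace FrobEuler

/-! ### Irreducible complex representations up to isomorphism -/

section Irreducible

variable (G : Type*) [Group G]

/-- Irreducible complex representations of `G` on some coordinate space `ℂ^m`. For a finite group
every irreducible complex representation is isomorphic to one of these. -/
structure IrrepModel where
  dim : ℕ
  rep : Representation ℂ G (Fin dim → ℂ)
  irreducible : rep.IsIrreducible

/-- Isomorphism of representations. -/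
instance IrrepModel.setoid : Setoid (IrrepModel G) where
  r ρ σ := Nonempty (ρ.rep.Equiv σ.rep)
  iseqv :=
    { refl := fun _ => ⟨Representation.Equiv.refl _⟩
      symm := fun ⟨e⟩ => ⟨e.symm⟩
      trans := fun ⟨e⟩ ⟨f⟩ => ⟨e.trans f⟩ }

/-- The set of isomorphism classes of irreducible complex representations of `G`. -/
def Irr : Type _ := Quotient (IrrepModel.setoid G)

variable {G}

/-- The dimension of an irreducible representation. -/
def Irr.dim (ρ : Irr G) : ℕ := (Quotient.out ρ).dim

/-- A representation in the isomorphism class `ρ`. -/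
def Irr.rep (ρ : Irr G) : Representation ℂ G (Fin ρ.dim → ℂ) := (Quotient.out ρ).rep

theorem Irr.rep_irreducible (ρ : Irr G) : ρ.rep.IsIrreducible := (Quotient.out ρ).irreducible

theorem Irr.eq_of_equiv {ρ σ : Irr G} (h : Nonempty (ρ.rep.Equiv σ.rep)) : ρ = σ := by
  rw [← Quotient.out_eq ρ, ← Quotient.out_eq σ]
  exact Quotient.sound h

/-- The pairing `⟨φ, ψ⟩ = |G|⁻¹ ∑_g φ(g) ψ(g⁻¹)`; for characters, `ψ(g⁻¹)` is the complex conjugate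
of `ψ(g)`, and for irreducible `ψ` this is the multiplicity of `ψ` in `φ`. -/
def charPairing [Fintype G] (φ ψ : G → ℂ) : ℂ :=
  (Nat.card G : ℂ)⁻¹ * ∑ g : G, φ g * ψ g⁻¹

theorem Irr.charPairing_eq [Fintype G] [DecidableEq (Irr G)] (ρ σ : Irr G) :
    charPairing ρ.rep.character σ.rep.character = if ρ = σ then 1 else 0 := by
  have := ρ.rep_irreducible
  have := σ.rep_irreducible
  have : Invertible (Nat.card G : ℂ) := invertibleOfNonzero (by simp)
  rw [charPairing, Representation.char_orthonormal]
  by_cases h : ρ = σ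
  · subst h
    rw [if_pos ⟨Representation.Equiv.refl _⟩, if_pos rfl]
  · rw [if_neg h, if_neg]
    intro hne
    exact h (Irr.eq_of_equiv hne).symm

theorem Irr.linearIndependent_character [Fintype G] :
    LinearIndependent ℂ (fun ρ : Irr G => (ρ.rep.character : G → ℂ)) := by
  classical
  rw [linearIndependent_iff']
  intro s a h σ hσ
  have key : charPairing (∑ ρ ∈ s, a ρ • (ρ.rep.character : G → ℂ)) σ.rep.character
      = ∑ ρ ∈ s, a ρ * charPairing ρ.rep.character σ.rep.character := by
    simp only [charPairing, Finset.sum_apply, Pi.smul_apply, smul_eq_mul, Finset.mul_sum,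
      Finset.sum_mul]
    rw [Finset.sum_comm]
    refine Finset.sum_congr rfl fun ρ _ => Finset.sum_congr rfl fun g _ => ?_
    ring
  rw [h] at key
  have h0 : charPairing (0 : G → ℂ) σ.rep.character = 0 := by simp [charPairing]
  rw [h0] at key
  simpa [Irr.charPairing_eq, hσ] using key.symm

/-- A finite group has finitely many irreducible representations. -/
instance Irr.instFinite [Fintype G] : Finite (Irr G) :=
  (Irr.linearIndependent_character (G := G)).finite

instance Irr.instFintype [Fintype G] : Fintype (Irr G) := Fintype.ofFinite _

variable (G)

/-- `R(G)`: the complex linear combinations of irreducible characters. -/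
def virtualChar : Submodule ℂ (G → ℂ) :=
  Submodule.span ℂ (Set.range fun ρ : Irr G => ρ.rep.character)

/-- `R(G, ℤ)`: the integer linear combinations of irreducible characters. -/
def integralVirtualChar : Submodule ℤ (G → ℂ) :=
  Submodule.span ℤ (Set.range fun ρ : Irr G => ρ.rep.character)

end Irreducible

/-! ### Tensor powers and cyclic tensor powers -/

section CyclicTensor

open scoped TensorProduct

variable {G V : Type*} [Group G] [AddCommGroup V] [Module ℂ V]

/-- The tensor power `ρ^{⊗ n}`, with tensor factors indexed by `ℤ/n`. -/
def tensorPow (ρ : Representation ℂ G V) (n : ℕ) :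
    Representation ℂ G (⨂[ℂ] _ : ZMod n, V) where
  toFun g := PiTensorProduct.map fun _ => ρ g
  map_one' := by
    simp only [map_one]
    exact PiTensorProduct.map_one
  map_mul' g h := by
    simp only [map_mul]
    exact PiTensorProduct.map_mul _ _

/-- The action of `m ∈ ℤ/n` on `V^{⊗ n}`, `m.(⨂ aᵢ) = ⨂ aᵢ₊ₘ`. -/
def cyclicShift (V : Type*) [AddCommGroup V] [Module ℂ V] (n : ℕ) (m : ZMod n) :
    (⨂[ℂ] _ : ZMod n, V) →ₗ[ℂ] (⨂[ℂ] _ : ZMod n, V) :=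
  (PiTensorProduct.reindex ℂ (fun _ : ZMod n => V) (Equiv.addRight m).symm).toLinearMap

theorem cyclicShift_tprod (n : ℕ) (m : ZMod n) (a : ZMod n → V) :
    cyclicShift V n m (PiTensorProduct.tprod ℂ a) = PiTensorProduct.tprod ℂ fun i => a (i + m) :=
  PiTensorProduct.reindex_tprod _ _

theorem tensorPow_cyclicShift (ρ : Representation ℂ G V) (n : ℕ) (m : ZMod n) (g : G)
    (v : ⨂[ℂ] _ : ZMod n, V) :
    tensorPow ρ n g (cyclicShift V n m v) = cyclicShift V n m (tensorPow ρ n g v) :=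
  PiTensorProduct.map_reindex (fun _ : ZMod n => ρ g) (Equiv.addRight m).symm v

/-- The subspace of `V^{⊗ n}` spanned by the vectors `ζ^m v - m.v`. -/
def cyclicRelations (V : Type*) [AddCommGroup V] [Module ℂ V] (n : ℕ) (ζ : ℂ) :
    Submodule ℂ (⨂[ℂ] _ : ZMod n, V) :=
  Submodule.span ℂ {w | ∃ (m : ℕ) (v : ⨂[ℂ] _ : ZMod n, V), w = ζ ^ m • v - cyclicShift V n m v}

theorem cyclicRelations_le_comap (ρ : Representation ℂ G V) (n : ℕ) (ζ : ℂ) (g : G) :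
    cyclicRelations V n ζ ≤ (cyclicRelations V n ζ).comap (tensorPow ρ n g) := by
  refine Submodule.span_le.mpr ?_
  rintro _ ⟨m, v, rfl⟩
  refine Submodule.subset_span ⟨m, tensorPow ρ n g v, ?_⟩
  rw [map_sub, map_smul, tensorPow_cyclicShift]

/-- The cyclic tensor power of `ρ` by `n`, formed with the primitive `n`-th root of unity `ζ`:
the representation induced by `ρ^{⊗ n}` on `V^{⊗ n} / ⟨(ζ^m - m).v⟩`. -/
def cyclicTensorPow (ρ : Representation ℂ G V) (n : ℕ) (ζ : ℂ) :
    Representation ℂ G ((⨂[ℂ] _ : ZMod n, V) ⧸ cyclicRelations V n ζ) :=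
  (tensorPow ρ n).quotient _ (cyclicRelations_le_comap ρ n ζ)

end CyclicTensor

/-! ### Formal power series -/

section Series

/-- The formal logarithm `log f = ∑_{k ≥ 1} (-1)^{k+1} (f - 1)^k / k` of a power series `f` with
constant term `1`. -/
def formalLog (f : ℂ⟦X⟧) : ℂ⟦X⟧ := (PowerSeries.log ℂ).subst (f - 1)

/-- The power series `det(I - A z^n)`. -/
def detSeries {V : Type*} [AddCommGroup V] [Module ℂ V] (A : V →ₗ[ℂ] V) (n : ℕ) : ℂ⟦X⟧ :=
  LinearMap.det (LinearMap.id - (PowerSeries.X ^ n : ℂ⟦X⟧) • A.baseChange ℂ⟦X⟧)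

/-- `s = ∑_{n ≥ 1} f n` in the `z`-adic topology: each coefficient of the partial sums is
eventually equal to that of `s`. -/
def HasSeriesSum (f : ℕ → ℂ⟦X⟧) (s : ℂ⟦X⟧) : Prop :=
  ∀ m : ℕ, ∀ᶠ N in Filter.atTop,
    PowerSeries.coeff m (∑ n ∈ Finset.Icc 1 N, f n) = PowerSeries.coeff m s

variable {G : Type*} [Group G] [Fintype G]

/-- The complex power series obtained by evaluating the coefficients of `Q` at `g ∈ G`. When `g`
is a Frobenius element at `p`, this is `Q_p(z)`. -/
def evalAt (Q : (G → ℂ)⟦X⟧) (g : G) : ℂ⟦X⟧ := Q.map (Pi.evalRingHom (fun _ : G => ℂ) g)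

/-- `log Q = ∑_{n ≥ 1} ∑_ρ q_{n,ρ} tr ρ(g) z^n` at the element `g`. -/
def TraceExpansionAt (Q : (G → ℂ)⟦X⟧) (q : ℕ → Irr G → ℂ) (g : G) : Prop :=
  HasSeriesSum
    (fun n => ∑ ρ : Irr G, (q n ρ * ρ.rep.character g) • (PowerSeries.X ^ n : ℂ⟦X⟧))
    (formalLog (evalAt Q g))

/-- `log Q = - ∑_{n ≥ 1} ∑_ρ b_{n,ρ} log det(I - ρ(g) z^n)` at the element `g`. -/
def DetExpansionAt (Q : (G → ℂ)⟦X⟧) (b : ℕ → Irr G → ℂ) (g : G) : Prop :=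
  HasSeriesSum
    (fun n => -∑ ρ : Irr G, b n ρ • formalLog (detSeries (ρ.rep g) n))
    (formalLog (evalAt Q g))

/-- The recursive sequence
`r_{n,ρ} = q_{n,ρ} - ∑_{d ∣ n, d > 1} ∑_γ (⟨γ^{⊗ d}, ρ⟩ / d) r_{n/d,γ}` for `n ≥ 1`. -/
def rSeq (q : ℕ → Irr G → ℂ) (n : ℕ) (ρ : Irr G) : ℂ :=
  q n ρ - ∑ d ∈ (n.divisors.filter (1 < ·)).attach, ∑ γ : Irr G,
    charPairing (tensorPow γ.rep d.1).character ρ.rep.character / (d.1 : ℂ) * rSeq q (n / d.1) γ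
termination_by n
decreasing_by
  have hd := d.2
  rw [Finset.mem_filter, Nat.mem_divisors] at hd
  exact Nat.div_lt_self (Nat.pos_of_ne_zero hd.1.2) hd.2

theorem rSeq_eq (q : ℕ → Irr G → ℂ) (n : ℕ) (ρ : Irr G) :
    rSeq q n ρ = q n ρ - ∑ d ∈ n.divisors.filter (1 < ·), ∑ γ : Irr G,
      charPairing (tensorPow γ.rep d).character ρ.rep.character / (d : ℂ) * rSeq q (n / d) γ := by
  rw [rSeq, ← Finset.sum_attach (n.divisors.filter (1 < ·))]

theorem rSeq_one (q : ℕ → Irr G → ℂ) (ρ : Irr G) : rSeq q 1 ρ = q 1 ρ := by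
  rw [rSeq_eq]
  simp [Finset.filter_singleton]

end Series

/-- `σ` is a Frobenius element at the prime number `p`, which is unramified in `E`: there is a prime
`P` of `E` above `p` with trivial inertia group at which `σ` is the Frobenius. Here the inertia
group acts trivially on every representation `V`, so that `V^{I_p} = V`. -/
def IsFrobAtUnramified (E : Type*) [Field E] [NumberField E] (p : ℕ) (σ : Gal(E/ℚ)) : Prop :=
  p.Prime ∧ ∃ P : Ideal (𝓞 E), P.IsPrime ∧ P.LiesOver (Ideal.span {(p : ℤ)}) ∧
    P.inertia Gal(E/ℚ) = ⊥ ∧ IsArithFrobAt ℤ σ P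

end FrobEuler

end

open scoped PowerSeries NumberField

noncomputable section

namespace FrobEuler

/-! The coefficients of `log Q` lie in $R(G)$, so orthonormality of characters gives the
$q_{n,\rho}$ and their uniqueness. Since $-\log\det(I-\rho(g)z^n)=\sum_k
\mathrm{tr}\,\rho(g^k)z^{nk}/k$, the determinant expansion says that the $m$-th coefficient is
$\sum_{d\mid m}\frac1d\sum_\rho b_{m/d,\rho}\chi_\rho(g^d)$. This system is triangular, so $b$ is
unique (`exponent_unique`).

The recursion for $r$ says exactly that $Q_g=\prod_{n,\gamma}(1-\chi_\gamma(g)z^n)^{-r_{n,\gamma}}$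
(`sum_character_eq_of_rSeq`). Each factor is turned into determinants by a character form of the
cyclotomic identity, $\sum_{d\mid l}\frac1d\chi_{V^{\otimes_{\rm cyc}l/d}}(g^d)=\frac1l\chi_V(g)^l$
(`sum_divisors_character_cyclicTensorPow`). It follows by Möbius inversion from the formula
$\frac1d\sum_{e\mid d}\mu(e)\chi_V(g^e)^{d/e}$ for the character of $V^{\otimes_{\rm cyc}d}$
(`character_cyclicTensorPow`). This yields (i).

For (ii), if $Q$ is integral, removing the factors with index at most $n$ leaves $1+az^{n+1}+\cdots$
with $a\in R(G,\mathbb Z)$, and the coordinates of $a$ are the $r_{n+1,\gamma}$. Hence $r$ is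
integral (`rSeq_integral`), and so is $b$, because multiplicities in cyclic tensor powers are
integers. -/

/-! ### Additivity of the trace and the rings of virtual characters. -/

theorem trace_eq_trace_restrict_add_trace_mapQ {K V : Type*} [Field K] [AddCommGroup V]
    [Module K V] [FiniteDimensional K V] (f : V →ₗ[K] V) (W : Submodule K V)
    (hf : W ≤ W.comap f) :
    LinearMap.trace K V f =
      LinearMap.trace K W (f.restrict hf) + LinearMap.trace K (V ⧸ W) (W.mapQ W f hf) := by
  obtain ⟨p, hp⟩ := W.subtype.exists_leftInverse_of_injective W.ker_subtype
  obtain ⟨s, hs⟩ := W.mkQ.exists_rightInverse_of_surjective W.range_mkQ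
  -- The identity of $V$ is split along $W\oplus s(V/W)$. Cyclicity of the trace then moves each
  -- summand to an endomorphism of $W$ or of $V/W$.
  have key : f = (f ∘ₗ W.subtype) ∘ₗ (p ∘ₗ (LinearMap.id - s ∘ₗ W.mkQ)) + (f ∘ₗ s) ∘ₗ W.mkQ := by
    ext v
    have hv : v - s (W.mkQ v) ∈ W := by
      rw [← Submodule.Quotient.mk_eq_zero, ← Submodule.mkQ_apply, map_sub]
      have := LinearMap.congr_fun hs (W.mkQ v)
      simp only [LinearMap.comp_apply, LinearMap.id_apply] at this
      rw [this, sub_self]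
    have h2 := LinearMap.congr_fun hp ⟨_, hv⟩
    simp only [LinearMap.comp_apply, Submodule.subtype_apply, LinearMap.id_apply] at h2
    simp only [LinearMap.add_apply, LinearMap.comp_apply, LinearMap.sub_apply, LinearMap.id_apply,
      Submodule.subtype_apply]
    rw [h2]
    simp
  conv_lhs => rw [key]
  rw [map_add, LinearMap.trace_comp_comm', LinearMap.trace_comp_comm' W.mkQ (f ∘ₗ s)]
  congr 2
  · ext w
    have h1 : (f.restrict hf w : V) = f w := rfl
    have h3 := LinearMap.congr_fun hp (f.restrict hf w)
    simp only [LinearMap.comp_apply, Submodule.subtype_apply, LinearMap.id_apply, h1] at h3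
    have h4 : W.mkQ (f w) = 0 := by
      rw [Submodule.mkQ_apply, Submodule.Quotient.mk_eq_zero]
      exact hf w.2
    simp only [LinearMap.comp_apply, LinearMap.sub_apply, LinearMap.id_apply,
      Submodule.subtype_apply, h4, map_zero, sub_zero]
    rw [h3]
  · rw [← LinearMap.comp_assoc, ← W.mapQ_mkQ W f (h := hf), LinearMap.comp_assoc, hs,
      LinearMap.comp_id]

section

variable {G : Type*} [Group G]

/-- `Irr` only contains models on coordinate spaces, so a basis transports $\sigma$ to such a model.
The chosen representative of its class is then only equivalent to it, which suffices for characters.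
-/
theorem character_mem_of_isIrreducible {V : Type*} [AddCommGroup V] [Module ℂ V]
    [FiniteDimensional ℂ V] (σ : Representation ℂ G V) (h : σ.IsIrreducible) :
    (σ.character : G → ℂ) ∈ integralVirtualChar G := by
  let e : V ≃ₗ[ℂ] (Fin (Module.finrank ℂ V) → ℂ) := (Module.finBasis ℂ V).equivFun
  let τ : Representation ℂ G (Fin (Module.finrank ℂ V) → ℂ) :=
    { toFun := fun g => e.conj (σ g)
      map_one' := by ext; simp
      map_mul' := fun g h => by simp [Module.End.mul_eq_comp, LinearEquiv.conj_comp] }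
  have he : ∀ g v, τ g (e v) = e (σ g v) := fun g v => by simp [τ, LinearEquiv.conj_apply]
  let φ : σ.Equiv τ := Representation.Equiv.mk e (fun g => by ext v : 1; simp [he])
  have hτ : τ.IsIrreducible := by
    have : Nontrivial (Subrepresentation τ) := ⟨⊥, ⊤, fun hbt => by
      have hV : ∀ v : V, v = 0 := fun v => by
        have hv : e v ∈ (⊥ : Subrepresentation τ) := hbt ▸ (trivial : e v ∈ (⊤ : Submodule ℂ _))
        exact e.map_eq_zero_iff.mp ((Submodule.mem_bot ℂ).mp hv)
      refine h.bot_ne_top (Subrepresentation.toSubmodule_injective ?_)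
      refine le_antisymm bot_le fun v _ => ?_
      rw [hV v]
      exact zero_mem _⟩
    refine ⟨fun W => ?_⟩
    let W' : Subrepresentation σ := ⟨W.toSubmodule.comap e.toLinearMap, fun g v hv => by
      change e (σ g v) ∈ W.toSubmodule
      rw [← he]
      exact W.apply_mem_toSubmodule g hv⟩
    have hW : W.toSubmodule = W'.toSubmodule.map e.toLinearMap :=
      (Submodule.map_comap_eq_of_surjective e.surjective _).symm
    refine (h.eq_bot_or_eq_top W').imp (fun h0 => ?_) fun h0 => ?_
    · refine Subrepresentation.toSubmodule_injective ?_
      rw [hW, h0]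
      exact Submodule.map_bot _
    · refine Subrepresentation.toSubmodule_injective ?_
      rw [hW, h0]
      exact (Submodule.map_top _).trans e.range
  let M : IrrepModel G := ⟨_, τ, hτ⟩
  have : Nonempty ((Quotient.out (Quotient.mk (IrrepModel.setoid G) M)).rep.Equiv τ) :=
    Quotient.exact (Quotient.out_eq (Quotient.mk (IrrepModel.setoid G) M))
  obtain ⟨ψ⟩ := this
  refine Submodule.subset_span ⟨Quotient.mk _ M, ?_⟩
  rw [Representation.char_iso φ, ← Representation.char_iso ψ]
  rfl

/-- Induction on the dimension: a proper nonzero invariant subspace and its quotient are both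
smaller. Additivity of the trace replaces complete reducibility, so $G$ may be infinite. -/
theorem character_mem_integralVirtualChar {V : Type*} [AddCommGroup V] [Module ℂ V]
    [FiniteDimensional ℂ V] (σ : Representation ℂ G V) :
    (σ.character : G → ℂ) ∈ integralVirtualChar G := by
  induction hn : Module.finrank ℂ V using Nat.strong_induction_on generalizing V with
  | _ n ih =>
    by_cases hσ : σ.IsIrreducible
    · exact character_mem_of_isIrreducible σ hσ
    rcases subsingleton_or_nontrivial V with hV | hV
    · have : (σ.character : G → ℂ) = 0 := by
        ext g
        simp [Representation.character, Subsingleton.elim (σ g) 0]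
      rw [this]
      exact zero_mem _
    have : ∃ W : Subrepresentation σ, W.toSubmodule ≠ ⊥ ∧ W.toSubmodule ≠ ⊤ := by
      by_contra! hW
      refine hσ ?_
      have : Nontrivial (Subrepresentation σ) := ⟨⊥, ⊤, fun h => by
        have := congrArg Subrepresentation.toSubmodule h
        exact bot_ne_top this⟩
      refine ⟨fun W => ?_⟩
      by_cases h : W.toSubmodule = ⊥
      · exact Or.inl (Subrepresentation.toSubmodule_injective h)
      · exact Or.inr (Subrepresentation.toSubmodule_injective (hW W h))
    obtain ⟨W, hW0, hW1⟩ := this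
    have hle : ∀ g, W.toSubmodule ≤ W.toSubmodule.comap (σ g) := fun g => W.apply_mem_toSubmodule g
    have hsum := W.toSubmodule.finrank_quotient_add_finrank
    have h0 : 0 < Module.finrank ℂ W.toSubmodule :=
      Nat.pos_of_ne_zero fun h => hW0 (Submodule.finrank_eq_zero.mp h)
    have h1 : Module.finrank ℂ W.toSubmodule < Module.finrank ℂ V :=
      Submodule.finrank_lt hW1
    have : (σ.character : G → ℂ) =
        W.toRepresentation.character + (σ.quotient W.toSubmodule hle).character := by
      ext g
      exact trace_eq_trace_restrict_add_trace_mapQ (σ g) W.toSubmodule (hle g)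
    rw [this]
    exact add_mem (ih _ (by omega) _ rfl) (ih _ (by omega) _ rfl)

theorem exists_int_of_mem_integralVirtualChar [Fintype G] {φ : G → ℂ}
    (hφ : φ ∈ integralVirtualChar G) :
    ∃ k : Irr G → ℤ, φ = ∑ ρ, (k ρ : ℂ) • (ρ.rep.character : G → ℂ) := by
  obtain ⟨k, hk⟩ := (Submodule.mem_span_range_iff_exists_fun ℤ).mp hφ
  exact ⟨k, by simp [← hk, Int.cast_smul_eq_zsmul]⟩

theorem exists_of_mem_virtualChar [Fintype G] {φ : G → ℂ} (hφ : φ ∈ virtualChar G) :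
    ∃ k : Irr G → ℂ, φ = ∑ ρ, k ρ • (ρ.rep.character : G → ℂ) := by
  obtain ⟨k, hk⟩ := (Submodule.mem_span_range_iff_exists_fun ℂ).mp hφ
  exact ⟨k, hk.symm⟩

theorem mem_virtualChar_of_mem_integral {φ : G → ℂ} (hφ : φ ∈ integralVirtualChar G) :
    φ ∈ virtualChar G :=
  Submodule.span_le_restrictScalars ℤ ℂ _ hφ

theorem charPairing_sum_smul [Fintype G] (k : Irr G → ℂ) (ρ : Irr G) :
    charPairing (∑ γ, k γ • (γ.rep.character : G → ℂ)) ρ.rep.character = k ρ := by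
  classical
  have key : charPairing (∑ γ, k γ • (γ.rep.character : G → ℂ)) ρ.rep.character
      = ∑ γ, k γ * charPairing γ.rep.character ρ.rep.character := by
    simp only [charPairing, Finset.sum_apply, Pi.smul_apply, smul_eq_mul, Finset.mul_sum,
      Finset.sum_mul]
    rw [Finset.sum_comm]
    refine Finset.sum_congr rfl fun ρ _ => Finset.sum_congr rfl fun g _ => ?_
    ring
  rw [key]
  simp [Irr.charPairing_eq]

theorem sum_charPairing_smul [Fintype G] {φ : G → ℂ} (hφ : φ ∈ virtualChar G) :
    ∑ ρ : Irr G, charPairing φ ρ.rep.character • (ρ.rep.character : G → ℂ) = φ := by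
  obtain ⟨k, rfl⟩ := exists_of_mem_virtualChar hφ
  simp only [charPairing_sum_smul]

theorem exists_int_charPairing [Fintype G] {φ : G → ℂ} (hφ : φ ∈ integralVirtualChar G)
    (ρ : Irr G) : ∃ k : ℤ, charPairing φ ρ.rep.character = k := by
  obtain ⟨k, rfl⟩ := exists_int_of_mem_integralVirtualChar hφ
  exact ⟨k ρ, charPairing_sum_smul _ ρ⟩

theorem one_mem_integralVirtualChar : (1 : G → ℂ) ∈ integralVirtualChar G := by
  have : (1 : G → ℂ) = (Representation.trivial ℂ G ℂ).character := by
    ext g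
    simp [Representation.character]
  rw [this]
  exact character_mem_integralVirtualChar _

/-- By bilinearity only irreducible characters matter, and their product is the character of a
tensor product. -/
theorem mul_mem_integralVirtualChar {φ ψ : G → ℂ} (hφ : φ ∈ integralVirtualChar G)
    (hψ : ψ ∈ integralVirtualChar G) : φ * ψ ∈ integralVirtualChar G := by
  induction hφ using Submodule.span_induction with
  | zero => rw [zero_mul]; exact zero_mem _
  | add x y _ _ hx hy => rw [add_mul]; exact add_mem hx hy
  | smul a x _ hx => rw [smul_mul_assoc]; exact Submodule.smul_mem _ _ hx
  | mem x hx =>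
    obtain ⟨ρ, rfl⟩ := hx
    induction hψ using Submodule.span_induction with
    | zero => rw [mul_zero]; exact zero_mem _
    | add x y _ _ hx hy => rw [mul_add]; exact add_mem hx hy
    | smul a x _ hx => rw [mul_smul_comm]; exact Submodule.smul_mem _ _ hx
    | mem x hx =>
      obtain ⟨σ, rfl⟩ := hx
      dsimp only
      rw [← Representation.char_tensor]
      exact character_mem_integralVirtualChar _

theorem mul_mem_virtualChar {φ ψ : G → ℂ} (hφ : φ ∈ virtualChar G)
    (hψ : ψ ∈ virtualChar G) : φ * ψ ∈ virtualChar G := by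
  induction hφ using Submodule.span_induction with
  | zero => rw [zero_mul]; exact zero_mem _
  | add x y _ _ hx hy => rw [add_mul]; exact add_mem hx hy
  | smul a x _ hx => rw [smul_mul_assoc]; exact Submodule.smul_mem _ _ hx
  | mem x hx =>
    induction hψ using Submodule.span_induction with
    | zero => rw [mul_zero]; exact zero_mem _
    | add x y _ _ hx hy => rw [mul_add]; exact add_mem hx hy
    | smul a x _ hx => rw [mul_smul_comm]; exact Submodule.smul_mem _ _ hx
    | mem y hy =>
      exact mem_virtualChar_of_mem_integral
        (mul_mem_integralVirtualChar (Submodule.subset_span hx) (Submodule.subset_span hy))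

variable (G) in
/-- The ring `R(G, ℤ)`. -/
def integralVirtualCharSubring : Subring (G → ℂ) where
  carrier := integralVirtualChar G
  mul_mem' := mul_mem_integralVirtualChar
  one_mem' := one_mem_integralVirtualChar
  add_mem' := add_mem
  zero_mem' := zero_mem _
  neg_mem' := neg_mem

/-- The polynomial $X^n-1$ is separable over $\mathbb C$, so $f$ is diagonalizable. This is applied
to $\rho(g)$ with $n=|G|$. -/
theorem exists_eigenbasis {V : Type*} [AddCommGroup V] [Module ℂ V] [FiniteDimensional ℂ V]
    (f : Module.End ℂ V) {n : ℕ} (hn : n ≠ 0) (hf : f ^ n = 1) :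
    ∃ (ι : Type) (_ : Fintype ι) (b : Module.Basis ι ℂ V) (l : ι → ℂ),
      ∀ i, f (b i) = l i • b i := by
  have hss : f.IsSemisimple := by
    refine Module.End.isSemisimple_of_squarefree_aeval_eq_zero (p := Polynomial.X ^ n - 1) ?_ ?_
    · have := (Polynomial.separable_X_pow_sub_C (1 : ℂ) (by exact_mod_cast hn) one_ne_zero)
      simpa using this.squarefree
    · simp [hf]
  have hint : DirectSum.IsInternal f.eigenspace :=
    DirectSum.isInternal_submodule_of_iSupIndep_of_iSup_eq_top f.eigenspaces_iSupIndep
      hss.iSup_eigenspace_eq_top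
  classical
  let B := hint.collectedBasis fun μ => Module.finBasis ℂ (f.eigenspace μ)
  refine ⟨_, FiniteDimensional.fintypeBasisIndex B, B, fun i => i.1, fun i => ?_⟩
  exact Module.End.mem_eigenspace_iff.mp (hint.collectedBasis_mem _ i)

end

/-! ### Traces of cyclic shifts and sums over roots of unity. -/

open scoped TensorProduct

theorem prod_quotient_addSubgroup {A R : Type*} [AddCommGroup A] [Fintype A] [CommMonoid R]
    (H : AddSubgroup A) [Fintype (A ⧸ H)] (F : A ⧸ H → R) :
    ∏ a : A, F a = ∏ q, F q ^ Nat.card H := by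
  classical
  have : Fintype H := Fintype.ofFinite H
  have key : ∀ p, F ((AddSubgroup.addGroupEquivQuotientProdAddSubgroup (s := H)).symm p : A)
      = F p.1 := fun p => by
    obtain ⟨a, rfl⟩ := (AddSubgroup.addGroupEquivQuotientProdAddSubgroup (s := H)).surjective p
    rw [Equiv.symm_apply_apply]
    rfl
  rw [← Equiv.prod_comp (AddSubgroup.addGroupEquivQuotientProdAddSubgroup (s := H)).symm]
  simp_rw [key]
  rw [Fintype.prod_prod_type]
  simp

/-- An $m$-invariant $p$ is a function on $A/\langle m\rangle$, and each coset has `addOrderOf m`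
elements. Expanding the power on the right as a product over cosets enumerates these functions. -/
theorem sum_prod_of_invariant {A ι R : Type*} [AddCommGroup A] [Fintype A] [DecidableEq A]
    [Fintype ι] [DecidableEq ι] [CommRing R] (l : ι → R) (m : A) :
    ∑ p : A → ι, (if (fun i => p (i + m)) = p then ∏ i, l (p i) else 0) =
      (∑ j, l j ^ addOrderOf m) ^ (Fintype.card A / addOrderOf m) := by
  classical
  let H := AddSubgroup.zmultiples m
  have hcard : Fintype.card (A ⧸ H) = Fintype.card A / addOrderOf m := by
    have h := H.card_eq_card_quotient_mul_card_addSubgroup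
    rw [Nat.card_zmultiples, Nat.card_eq_fintype_card, Nat.card_eq_fintype_card] at h
    rw [h, Nat.mul_div_cancel _ (addOrderOf_pos m)]
  rw [← hcard, ← Finset.card_univ, ← Finset.prod_const, Finset.prod_univ_sum,
    Fintype.piFinset_univ, ← Finset.sum_filter]
  symm
  refine Finset.sum_bij (fun p _ a => p (a : A ⧸ H)) ?_ ?_ ?_ ?_
  · intro p _
    refine Finset.mem_filter.mpr ⟨Finset.mem_univ _, funext fun i => ?_⟩
    have : ((i + m : A) : A ⧸ H) = i := (QuotientAddGroup.eq (s := H)).mpr (by simp [H])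
    exact congrArg p this
  · intro p _ p' _ h
    funext q
    obtain ⟨a, rfl⟩ := QuotientAddGroup.mk_surjective q
    exact congrFun h a
  · intro p hp
    have hp' : ∀ i, p (i + m) = p i := congrFun (Finset.mem_filter.mp hp).2
    have hp2 : ∀ (k : ℕ) i, p (i + k • m) = p i := by
      intro k
      induction k with
      | zero => simp
      | succ k ih => intro i; rw [succ_nsmul, ← add_assoc, hp', ih]
    refine ⟨fun q => Quotient.liftOn' q p ?_, Finset.mem_univ _, rfl⟩
    intro a b hab
    rw [QuotientAddGroup.leftRel_apply, ← mem_multiples_iff_mem_zmultiples] at hab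
    obtain ⟨k, hk⟩ := hab
    have : b = a + k • m := by
      simp only at hk
      rw [hk]; abel
    rw [this, hp2]
  · intro p _
    rw [prod_quotient_addSubgroup H (fun q => l (p q)), Nat.card_zmultiples]

theorem trace_pow_of_eigenbasis {V ι : Type*} [AddCommGroup V] [Module ℂ V] [Fintype ι]
    (f : Module.End ℂ V) (b : Module.Basis ι ℂ V) (l : ι → ℂ) (hb : ∀ i, f (b i) = l i • b i)
    (k : ℕ) : LinearMap.trace ℂ V (f ^ k) = ∑ i, l i ^ k := by
  classical
  have hpow : ∀ i, (f ^ k) (b i) = l i ^ k • b i := by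
    intro i
    induction k with
    | zero => simp
    | succ k ih => rw [pow_succ, Module.End.mul_apply, hb, map_smul, ih, smul_smul, pow_succ']
  rw [LinearMap.trace_eq_matrix_trace ℂ b, Matrix.trace]
  refine Finset.sum_congr rfl fun i _ => ?_
  rw [Matrix.diag_apply, LinearMap.toMatrix_apply, hpow]
  simp

/-- In the tensor basis built from eigenvectors of $f$, only shift-invariant index functions have a
nonzero diagonal entry. Each cycle of the shift contributes one factor
$\mathrm{tr}(f^{\mathrm{ord}(m)})$. -/
theorem trace_map_comp_cyclicShift {V : Type*} [AddCommGroup V] [Module ℂ V]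
    [FiniteDimensional ℂ V] (f : Module.End ℂ V) {N : ℕ} (hN : N ≠ 0) (hf : f ^ N = 1) (d : ℕ)
    [NeZero d] (m : ZMod d) :
    LinearMap.trace ℂ _ (PiTensorProduct.map (fun _ : ZMod d => f) ∘ₗ cyclicShift V d m) =
      LinearMap.trace ℂ V (f ^ addOrderOf m) ^ (d / addOrderOf m) := by
  classical
  obtain ⟨ι, _, b, l, hb⟩ := exists_eigenbasis f hN hf
  have h := sum_prod_of_invariant l m
  rw [ZMod.card] at h
  rw [trace_pow_of_eigenbasis f b l hb, ← h,
    LinearMap.trace_eq_matrix_trace ℂ (Basis.piTensorProduct fun _ : ZMod d => b),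
    Matrix.trace]
  refine Finset.sum_congr rfl fun p _ => ?_
  rw [Matrix.diag_apply, LinearMap.toMatrix_apply, LinearMap.comp_apply,
    Basis.piTensorProduct_apply, cyclicShift_tprod, PiTensorProduct.map_tprod]
  simp_rw [hb]
  rw [MultilinearMap.map_smul_univ, map_smul, Finsupp.smul_apply,
    Basis.piTensorProduct_repr_tprod_apply, smul_eq_mul]
  simp only [Module.Basis.repr_self, Finsupp.single_apply]
  rw [Finset.prod_ite_zero]
  have hl : ∏ i, l (p (i + m)) = ∏ i, l (p i) :=
    Equiv.prod_comp (Equiv.addRight m) fun i => l (p i)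
  rw [hl]
  simp only [funext_iff, Finset.mem_univ, forall_const, Finset.prod_const_one, mul_ite, mul_one,
    mul_zero]

/-- The additive character of `ℤ/d` that maps `1` to the primitive root of unity `ζ`. -/
def rootChar {d : ℕ} [NeZero d] {ζ : ℂ} (hζ : IsPrimitiveRoot ζ d) : AddChar (ZMod d) ℂ :=
  AddChar.zmodChar d hζ.pow_eq_one

theorem rootChar_natCast {d : ℕ} [NeZero d] {ζ : ℂ} (hζ : IsPrimitiveRoot ζ d) (k : ℕ) :
    rootChar hζ k = ζ ^ k :=
  AddChar.zmodChar_apply' _ _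

theorem rootChar_injective {d : ℕ} [NeZero d] {ζ : ℂ} (hζ : IsPrimitiveRoot ζ d) :
    Function.Injective (rootChar hζ) := fun a b hab =>
  ZMod.val_injective d (hζ.pow_inj a.val_lt b.val_lt hab)

theorem orderOf_rootChar {d : ℕ} [NeZero d] {ζ : ℂ} (hζ : IsPrimitiveRoot ζ d) (m : ZMod d) :
    orderOf (rootChar hζ m) = addOrderOf m := by
  refine Nat.dvd_antisymm (orderOf_dvd_of_pow_eq_one ?_) (addOrderOf_dvd_of_nsmul_eq_zero ?_)
  · rw [← AddChar.map_nsmul_eq_pow, addOrderOf_nsmul_eq_zero, AddChar.map_zero_eq_one]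
  · refine rootChar_injective hζ ?_
    rw [AddChar.map_nsmul_eq_pow, pow_orderOf_eq_one, AddChar.map_zero_eq_one]

/-- The character takes each $d$-th root of unity as a value exactly once; these are grouped by
order. -/
theorem sum_rootChar {d : ℕ} [NeZero d] {ζ : ℂ} (hζ : IsPrimitiveRoot ζ d) (F : ℂ → ℂ) :
    ∑ m, F (rootChar hζ m) = ∑ e ∈ d.divisors, ∑ x ∈ primitiveRoots e ℂ, F x := by
  classical
  rw [← Finset.sum_biUnion fun i _ j _ h => IsPrimitiveRoot.disjoint h,
    ← IsPrimitiveRoot.nthRoots_one_eq_biUnion_primitiveRoots,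
    ← Finset.sum_image (rootChar_injective hζ).injOn]
  congr 1
  refine Finset.eq_of_subset_of_card_le (fun x hx => ?_) ?_
  · obtain ⟨m, _, rfl⟩ := Finset.mem_image.mp hx
    rw [Polynomial.mem_nthRootsFinset (NeZero.pos d), ← AddChar.map_nsmul_eq_pow]
    simp
  · rw [hζ.card_nthRootsFinset, Finset.card_image_of_injective _ (rootChar_injective hζ)]
    simp

/-- Möbius inversion of the vanishing of the sum of all $n$-th roots of unity for $n>1$. -/
theorem sum_primitiveRoots_eq_moebius {e : ℕ} (he : 0 < e) :
    ∑ x ∈ primitiveRoots e ℂ, x = (ArithmeticFunction.moebius e : ℂ) := by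
  have h : ∀ n > 0, ∑ i ∈ n.divisors, ∑ x ∈ primitiveRoots i ℂ, x =
      if n = 1 then (1 : ℂ) else 0 := by
    intro n hn
    have : NeZero n := ⟨hn.ne'⟩
    have hζ := Complex.isPrimitiveRoot_exp n hn.ne'
    rw [← sum_rootChar hζ fun x => x]
    split_ifs with h1
    · subst h1
      rw [Fintype.sum_eq_single (0 : ZMod 1) fun x hx => (hx (Subsingleton.elim _ _)).elim,
        AddChar.map_zero_eq_one]
    · refine AddChar.sum_eq_zero_of_ne_one fun h => h1 ?_
      have h2 := rootChar_natCast hζ 1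
      rw [h, AddChar.one_apply, pow_one] at h2
      rw [hζ.eq_orderOf, ← h2, orderOf_one]
  have := (ArithmeticFunction.sum_eq_iff_sum_mul_moebius_eq.mp h) e he
  rw [← this, Finset.sum_eq_single (e, 1)]
  · simp
  · intro x hx hne
    rw [if_neg, mul_zero]
    intro h1
    refine hne ?_
    have := (Nat.mem_divisorsAntidiagonal.mp hx).1
    rw [h1, mul_one] at this
    exact Prod.ext this h1
  · intro hx
    simp [he.ne'] at hx

theorem sum_rootChar_neg_mul {d : ℕ} [NeZero d] {ζ : ℂ} (hζ : IsPrimitiveRoot ζ d) (h : ℕ → ℂ) :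
    ∑ m, rootChar hζ (-m) * h (addOrderOf m) =
      ∑ e ∈ d.divisors, (ArithmeticFunction.moebius e : ℂ) * h e := by
  rw [← Equiv.sum_comp (Equiv.neg (ZMod d))]
  simp only [Equiv.neg_apply, neg_neg, addOrderOf_neg]
  simp only [← orderOf_rootChar hζ]
  rw [sum_rootChar hζ fun x => x * h (orderOf x)]
  refine Finset.sum_congr rfl fun e he => ?_
  rw [← sum_primitiveRoots_eq_moebius (Nat.pos_of_mem_divisors he), Finset.sum_mul]
  refine Finset.sum_congr rfl fun x hx => ?_
  rw [← (isPrimitiveRoot_of_mem_primitiveRoots hx).eq_orderOf]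

/-! ### The character of a cyclic tensor power. -/

theorem cyclicShift_add (V : Type*) [AddCommGroup V] [Module ℂ V] (d : ℕ) (m k : ZMod d)
    (v : ⨂[ℂ] _ : ZMod d, V) :
    cyclicShift V d m (cyclicShift V d k v) = cyclicShift V d (m + k) v := by
  have : cyclicShift V d m ∘ₗ cyclicShift V d k = cyclicShift V d (m + k) := by
    ext a
    simp only [LinearMap.compMultilinearMap_apply, LinearMap.comp_apply, cyclicShift_tprod]
    congr 1
    funext i
    rw [add_assoc]
  exact LinearMap.congr_fun this v

theorem finiteDimensional_piTensorProduct (V : Type*) [AddCommGroup V] [Module ℂ V]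
    [FiniteDimensional ℂ V] (d : ℕ) [NeZero d] :
    FiniteDimensional ℂ (PiTensorProduct ℂ fun _ : ZMod d => V) :=
  Module.Basis.finiteDimensional_of_finite
    (Basis.piTensorProduct fun _ : ZMod d => Module.finBasis ℂ V)

/-- The projection of `V^{⊗ d}` onto the `ζ`-isotypic component of the cyclic shift. -/
def cyclicProj (V : Type*) [AddCommGroup V] [Module ℂ V] {d : ℕ} [NeZero d] {ζ : ℂ}
    (hζ : IsPrimitiveRoot ζ d) : (⨂[ℂ] _ : ZMod d, V) →ₗ[ℂ] (⨂[ℂ] _ : ZMod d, V) :=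
  (d : ℂ)⁻¹ • ∑ m, rootChar hζ (-m) • cyclicShift V d m

theorem cyclicProj_apply (V : Type*) [AddCommGroup V] [Module ℂ V] {d : ℕ} [NeZero d] {ζ : ℂ}
    (hζ : IsPrimitiveRoot ζ d) (v : ⨂[ℂ] _ : ZMod d, V) :
    cyclicProj V hζ v = (d : ℂ)⁻¹ • ∑ m, rootChar hζ (-m) • cyclicShift V d m v := by
  simp [cyclicProj, LinearMap.sum_apply]

theorem cyclicRelations_le_ker_cyclicProj (V : Type*) [AddCommGroup V] [Module ℂ V] {d : ℕ}
    [NeZero d] {ζ : ℂ} (hζ : IsPrimitiveRoot ζ d) :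
    cyclicRelations V d ζ ≤ LinearMap.ker (cyclicProj V hζ) := by
  refine Submodule.span_le.mpr ?_
  rintro _ ⟨k, v, rfl⟩
  rw [SetLike.mem_coe, LinearMap.mem_ker, map_sub, sub_eq_zero, map_smul, cyclicProj_apply,
    cyclicProj_apply, smul_comm]
  congr 1
  rw [← Equiv.sum_comp (Equiv.addRight (k : ZMod d)), Finset.smul_sum]
  refine Finset.sum_congr rfl fun m _ => ?_
  rw [cyclicShift_add, smul_smul, Equiv.coe_addRight, ← rootChar_natCast hζ,
    ← AddChar.map_add_eq_mul, neg_add_rev, add_neg_cancel_left]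

theorem cyclicProj_sub_mem (V : Type*) [AddCommGroup V] [Module ℂ V] {d : ℕ}
    [NeZero d] {ζ : ℂ} (hζ : IsPrimitiveRoot ζ d) (v : ⨂[ℂ] _ : ZMod d, V) :
    cyclicProj V hζ v - v ∈ cyclicRelations V d ζ := by
  have : cyclicProj V hζ v - v = (d : ℂ)⁻¹ • ∑ m, rootChar hζ (-m) •
      (cyclicShift V d m v - rootChar hζ m • v) := by
    simp only [smul_sub, smul_smul, ← AddChar.map_add_eq_mul, neg_add_cancel,
      AddChar.map_zero_eq_one, Finset.sum_sub_distrib, cyclicProj_apply]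
    simp [← Nat.cast_smul_eq_nsmul ℂ, smul_smul, NeZero.ne d]
  rw [this]
  refine Submodule.smul_mem _ _ (Submodule.sum_mem _ fun m _ => Submodule.smul_mem _ _ ?_)
  rw [← neg_sub]
  refine neg_mem (Submodule.subset_span ⟨m.val, v, ?_⟩)
  rw [← rootChar_natCast hζ, ZMod.natCast_zmod_val]

variable {G : Type*} [Group G]

theorem character_tensorPow [Finite G] {V : Type*} [AddCommGroup V] [Module ℂ V]
    [FiniteDimensional ℂ V] (ρ : Representation ℂ G V) (d : ℕ) [NeZero d] (g : G) :
    (tensorPow ρ d).character g = ρ.character g ^ d := by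
  have h := trace_map_comp_cyclicShift (ρ g) (Nat.card_pos (α := G)).ne'
    (by rw [← map_pow, pow_card_eq_one', map_one]) d 0
  have h0 : cyclicShift V d 0 = LinearMap.id := by
    ext a
    simp only [LinearMap.compMultilinearMap_apply, cyclicShift_tprod, LinearMap.id_apply]
    congr 1
    funext i
    rw [add_zero]
  rw [h0, LinearMap.comp_id, addOrderOf_zero, pow_one, Nat.div_one] at h
  exact h

/-- Composing the action of $g$ with `cyclicProj` gives a map that is zero on the relations and
agrees with $g$ on the quotient. Its trace is therefore the required one, and it is an average of
traces of shifts; grouping the shifts by order produces $\mu$, whichever $\zeta$ is chosen. -/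
theorem character_cyclicTensorPow [Finite G] {V : Type*} [AddCommGroup V] [Module ℂ V]
    [FiniteDimensional ℂ V] (ρ : Representation ℂ G V) (d : ℕ) [NeZero d] {ζ : ℂ}
    (hζ : IsPrimitiveRoot ζ d) (g : G) :
    (cyclicTensorPow ρ d ζ).character g = (d : ℂ)⁻¹ * ∑ e ∈ d.divisors,
      (ArithmeticFunction.moebius e : ℂ) * ρ.character (g ^ e) ^ (d / e) := by
  have := finiteDimensional_piTensorProduct V d
  let T := tensorPow ρ d g
  let W := cyclicRelations V d ζ
  have hTW : W ≤ W.comap T := cyclicRelations_le_comap ρ d ζ g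
  have hE : W ≤ W.comap (T ∘ₗ cyclicProj V hζ) := fun w hw => by
    rw [Submodule.mem_comap, LinearMap.comp_apply,
      LinearMap.mem_ker.mp (cyclicRelations_le_ker_cyclicProj V hζ hw), map_zero]
    exact zero_mem _
  have h0 : (T ∘ₗ cyclicProj V hζ).restrict (p := W) (q := W) hE = 0 := by
    ext w
    change T (cyclicProj V hζ w) = 0
    rw [LinearMap.mem_ker.mp (cyclicRelations_le_ker_cyclicProj V hζ w.2), map_zero]
  have h1 : W.mapQ W (T ∘ₗ cyclicProj V hζ) hE = W.mapQ W T hTW := by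
    refine Submodule.linearMap_qext _ (LinearMap.ext fun v => ?_)
    simp only [LinearMap.comp_apply, Submodule.mkQ_apply, Submodule.mapQ_apply]
    rw [Submodule.Quotient.eq, ← map_sub]
    exact hTW (cyclicProj_sub_mem V hζ v)
  have h2 := trace_eq_trace_restrict_add_trace_mapQ (T ∘ₗ cyclicProj V hζ) W hE
  rw [h0, h1, map_zero, zero_add] at h2
  have h3 : (cyclicTensorPow ρ d ζ).character g = LinearMap.trace ℂ _ (W.mapQ W T hTW) := rfl
  rw [h3, ← h2, ← sum_rootChar_neg_mul hζ fun e => ρ.character (g ^ e) ^ (d / e)]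
  have h4 : T ∘ₗ cyclicProj V hζ =
      (d : ℂ)⁻¹ • ∑ m, rootChar hζ (-m) • (T ∘ₗ cyclicShift V d m) := by
    refine LinearMap.ext fun v => ?_
    simp only [LinearMap.comp_apply, cyclicProj_apply, map_smul, map_sum, LinearMap.smul_apply,
      LinearMap.sum_apply]
  rw [h4, map_smul, smul_eq_mul, map_sum]
  congr 1
  refine Finset.sum_congr rfl fun m _ => ?_
  rw [map_smul, smul_eq_mul]
  congr 1
  have h := trace_map_comp_cyclicShift (ρ g) (Nat.card_pos (α := G)).ne'
    (by rw [← map_pow, pow_card_eq_one', map_one]) d m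
  rw [← map_pow ρ] at h
  exact h

/-! ### Formal logarithms of determinants and coefficientwise forms of the expansions. -/

open PowerSeries

theorem constantCoeff_formalLog {f : ℂ⟦X⟧} (hf : constantCoeff f = 1) :
    constantCoeff (formalLog f) = 0 :=
  constantCoeff_logOf hf

theorem derivative_formalLog_mul {f : ℂ⟦X⟧} (hf : constantCoeff f = 1) :
    d⁄dX ℂ (formalLog f) * f = d⁄dX ℂ f := by
  have hs : HasSubst (f - 1) := HasSubst.of_constantCoeff_zero' (by simp [hf])
  have h1 : d⁄dX ℂ (log ℂ) * (1 + X) = 1 := by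
    rw [deriv_log]
    ext n
    cases n with
    | zero => simp
    | succ n => rw [mul_add, mul_one, map_add, coeff_succ_mul_X]; simp [pow_succ, coeff_one]
  have h2 := congrArg (substAlgHom (R := ℂ) hs) h1
  rw [map_mul, map_add, map_one, substAlgHom_X, add_sub_cancel, coe_substAlgHom] at h2
  rw [formalLog, derivative_subst hs, map_sub, derivative_one, sub_zero, mul_right_comm, h2,
    one_mul]

/-- Any logarithmic derivative $L$ of $f$ determines `formalLog f`, so later computations never
expand the logarithm itself. -/
theorem coeff_formalLog_of_mul_eq {f L : ℂ⟦X⟧} (hf : constantCoeff f = 1)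
    (hL : L * f = d⁄dX ℂ f) (n : ℕ) :
    coeff (n + 1) (formalLog f) * (n + 1) = coeff n L := by
  have hf0 : f ≠ 0 := by
    rintro rfl
    simp at hf
  have : d⁄dX ℂ (formalLog f) = L :=
    mul_right_cancel₀ hf0 ((derivative_formalLog_mul hf).trans hL.symm)
  rw [← this, coeff_derivative]

section

variable {R : Type*} [CommRing R]

theorem sum_mul_prod_eq_derivative_prod {ι : Type*} (s : Finset ι) (f L : ι → R⟦X⟧)
    (h : ∀ i ∈ s, L i * f i = d⁄dX R (f i)) :
    (∑ i ∈ s, L i) * ∏ i ∈ s, f i = d⁄dX R (∏ i ∈ s, f i) := by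
  classical
  induction s using Finset.induction_on with
  | empty => simp
  | insert a s ha ih =>
    rw [Finset.sum_insert ha, Finset.prod_insert ha, Derivation.leibniz, smul_eq_mul, smul_eq_mul,
      ← ih fun i hi => h i (Finset.mem_insert_of_mem hi), ← h a (Finset.mem_insert_self a s)]
    ring

/-- The power series `n a z^(n-1) / (1 - a z^n)`. -/
def geomLogDeriv (a : R) (n : ℕ) : R⟦X⟧ :=
  PowerSeries.mk fun k => if n ∣ k + 1 then (n : R) * a ^ ((k + 1) / n) else 0

theorem neg_geomLogDeriv_mul (a : R) {n : ℕ} (hn : n ≠ 0) :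
    -geomLogDeriv a n * (1 - C a * X ^ n) = d⁄dX R (1 - C a * X ^ n) := by
  obtain ⟨n, rfl⟩ := Nat.exists_eq_succ_of_ne_zero hn
  have h : geomLogDeriv a (n + 1) - C a * (geomLogDeriv a (n + 1) * X ^ (n + 1)) =
      C a * (((n + 1 : ℕ) : R⟦X⟧) * X ^ n) := by
    ext k
    rw [map_sub, coeff_C_mul, coeff_C_mul, coeff_mul_X_pow', ← nsmul_eq_mul, map_nsmul, coeff_X_pow,
      geomLogDeriv, coeff_mk, coeff_mk, nsmul_eq_mul]
    rcases lt_trichotomy k n with hk | rfl | hk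
    · rw [if_neg (Nat.not_dvd_of_pos_of_lt (by omega) (by omega)), if_neg (by omega),
        if_neg (by omega)]
      simp
    · rw [if_pos dvd_rfl, if_neg (by omega), if_pos rfl, Nat.div_self (by omega)]
      ring
    · rw [if_pos (show n + 1 ≤ k from hk), if_neg (show ¬ k = n by omega)]
      obtain ⟨j, rfl⟩ := Nat.exists_eq_add_of_le (show n + 1 ≤ k from hk)
      have h1 : n + 1 + j + 1 = j + 1 + (n + 1) := by ring
      rw [Nat.add_sub_cancel_left, h1, Nat.add_div_right _ (by omega)]
      simp only [Nat.dvd_add_self_right]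
      split_ifs
      · rw [pow_succ]; ring
      · ring
  rw [map_sub, derivative_one, Derivation.leibniz, derivative_C, smul_zero, add_zero,
    derivative_pow, derivative_X, smul_eq_mul, mul_one, Nat.succ_sub_one, zero_sub, Nat.succ_eq_add_one, ← h]
  ring

end

theorem detSeries_eq_prod {V ι : Type*} [AddCommGroup V] [Module ℂ V] [Fintype ι]
    (A : V →ₗ[ℂ] V) (b : Module.Basis ι ℂ V) (l : ι → ℂ) (hb : ∀ i, A (b i) = l i • b i)
    (n : ℕ) : detSeries A n = ∏ i, (1 - C (l i) * X ^ n) := by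
  classical
  rw [detSeries, ← LinearMap.det_toMatrix (b.baseChange ℂ⟦X⟧), ← Matrix.det_diagonal]
  congr 1
  ext1 i j
  rw [LinearMap.toMatrix_apply]
  simp only [LinearMap.sub_apply, LinearMap.id_apply, LinearMap.smul_apply,
    Module.Basis.baseChange_apply, LinearMap.baseChange_tmul, hb, map_sub,
    TensorProduct.tmul_smul, TensorProduct.smul_tmul', Finsupp.sub_apply,
    Module.Basis.baseChange_repr_tmul, Module.Basis.repr_self]
  rcases eq_or_ne i j with rfl | hij
  · simp [smul_eq_C_mul, mul_comm]
  · simp [Finsupp.single_eq_of_ne hij, Matrix.diagonal_apply_ne _ hij]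

theorem constantCoeff_one_sub_C_mul_X_pow {R : Type*} [CommRing R] (a : R) {n : ℕ} (hn : n ≠ 0) :
    constantCoeff (1 - C a * X ^ n : R⟦X⟧) = 1 := by
  simp [hn]

section

variable {G : Type*} [Group G] {V : Type*} [AddCommGroup V] [Module ℂ V] [FiniteDimensional ℂ V]

theorem constantCoeff_formalLog_detSeries [Finite G] (ρ : Representation ℂ G V) (g : G) {n : ℕ}
    (hn : n ≠ 0) : constantCoeff (formalLog (detSeries (ρ g) n)) = 0 := by
  obtain ⟨ι, _, b, l, hb⟩ := exists_eigenbasis (ρ g) (Nat.card_pos (α := G)).ne'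
    (by rw [← map_pow, pow_card_eq_one', map_one])
  refine constantCoeff_formalLog ?_
  rw [detSeries_eq_prod _ b l hb, map_prod]
  exact Finset.prod_eq_one fun i _ => constantCoeff_one_sub_C_mul_X_pow _ hn

theorem coeff_formalLog_detSeries [Finite G] (ρ : Representation ℂ G V) (g : G) {n m : ℕ}
    (hn : n ≠ 0) (hm : 1 ≤ m) :
    coeff m (formalLog (detSeries (ρ g) n)) =
      if n ∣ m then -((n : ℂ) / m * ρ.character (g ^ (m / n))) else 0 := by
  obtain ⟨k, rfl⟩ := Nat.exists_eq_add_of_le' hm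
  have hk : ((k : ℂ) + 1) ≠ 0 := by exact_mod_cast k.succ_ne_zero
  obtain ⟨ι, _, b, l, hb⟩ := exists_eigenbasis (ρ g) (Nat.card_pos (α := G)).ne'
    (by rw [← map_pow, pow_card_eq_one', map_one])
  have h0 : constantCoeff (detSeries (ρ g) n) = 1 := by
    rw [detSeries_eq_prod _ b l hb, map_prod]
    exact Finset.prod_eq_one fun i _ => constantCoeff_one_sub_C_mul_X_pow _ hn
  have hL : (∑ i, -geomLogDeriv (l i) n) * detSeries (ρ g) n = d⁄dX ℂ (detSeries (ρ g) n) := by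
    rw [detSeries_eq_prod _ b l hb]
    exact sum_mul_prod_eq_derivative_prod _ _ _ fun i _ => neg_geomLogDeriv_mul _ hn
  rw [← mul_left_inj' hk, coeff_formalLog_of_mul_eq h0 hL, map_sum]
  simp only [map_neg, geomLogDeriv, coeff_mk]
  split_ifs
  · rw [Representation.character, map_pow, trace_pow_of_eigenbasis _ b l hb, Finset.sum_neg_distrib,
      ← Finset.mul_sum]
    push_cast
    field_simp
  · simp

end

/-- Terms with index beyond $m$ do not touch the $m$-th coefficient, so convergence becomes a family
of finite identities. -/
theorem hasSeriesSum_iff {f : ℕ → ℂ⟦X⟧} {s : ℂ⟦X⟧} (hf : ∀ n m, m < n → coeff m (f n) = 0)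
    (hs : constantCoeff s = 0) :
    HasSeriesSum f s ↔ ∀ m, 1 ≤ m → ∑ n ∈ Finset.Icc 1 m, coeff m (f n) = coeff m s := by
  have key : ∀ m N, m ≤ N →
      coeff m (∑ n ∈ Finset.Icc 1 N, f n) = ∑ n ∈ Finset.Icc 1 m, coeff m (f n) := by
    intro m N hmN
    rw [map_sum]
    refine (Finset.sum_subset (Finset.Icc_subset_Icc_right hmN) fun n _ hn => hf _ _ ?_).symm
    simp only [Finset.mem_Icc] at *
    omega
  constructor
  · intro h m _
    obtain ⟨N, hN, hmN⟩ := ((h m).and (Filter.eventually_ge_atTop m)).exists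
    rw [← key m N hmN, hN]
  · intro h m
    filter_upwards [Filter.eventually_ge_atTop m] with N hN
    rw [key m N hN]
    rcases Nat.eq_zero_or_pos m with rfl | hm
    · simp [hs]
    · exact h m hm

section

variable {G : Type*} [Group G] [Fintype G] {Q : (G → ℂ)⟦X⟧}

omit [Group G] [Fintype G] in
theorem constantCoeff_evalAt (hQ : constantCoeff Q = 1) (g : G) :
    constantCoeff (evalAt Q g) = 1 := by
  rw [evalAt, ← coeff_zero_eq_constantCoeff_apply, coeff_map, coeff_zero_eq_constantCoeff_apply, hQ]
  simp

theorem traceExpansionAt_iff (hQ : constantCoeff Q = 1) (q : ℕ → Irr G → ℂ) (g : G) :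
    TraceExpansionAt Q q g ↔ ∀ m, 1 ≤ m →
      ∑ ρ : Irr G, q m ρ * ρ.rep.character g = coeff m (formalLog (evalAt Q g)) := by
  rw [TraceExpansionAt, hasSeriesSum_iff _ (constantCoeff_formalLog (constantCoeff_evalAt hQ g))]
  · refine forall₂_congr fun m hm => ?_
    simp only [map_sum, coeff_smul, coeff_X_pow, smul_eq_mul, mul_ite, mul_one, mul_zero]
    rw [Finset.sum_eq_single_of_mem m (Finset.mem_Icc.mpr ⟨hm, le_rfl⟩)]
    · simp
    · intro n _ hn
      simp [hn.symm]
  · intro n m hm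
    simp [coeff_X_pow, hm.ne]

theorem detExpansionAt_iff (hQ : constantCoeff Q = 1) (b : ℕ → Irr G → ℂ) (g : G) :
    DetExpansionAt Q b g ↔ ∀ m : ℕ, 1 ≤ m →
      ∑ d ∈ m.divisors, (d : ℂ)⁻¹ * ∑ ρ : Irr G, b (m / d) ρ * ρ.rep.character (g ^ d) =
        coeff m (formalLog (evalAt Q g)) := by
  rw [DetExpansionAt, hasSeriesSum_iff _ (constantCoeff_formalLog (constantCoeff_evalAt hQ g))]
  · refine forall₂_congr fun m hm => ?_
    have key : ∑ n ∈ Finset.Icc 1 m, coeff m (-∑ ρ : Irr G,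
        b n ρ • formalLog (detSeries (ρ.rep g) n)) = ∑ n ∈ m.divisors,
          (n : ℂ) / m * ∑ ρ : Irr G, b n ρ * ρ.rep.character (g ^ (m / n)) := by
      have hdiv : m.divisors = (Finset.Icc 1 m).filter (· ∣ m) := by
        ext n
        simp only [Nat.mem_divisors, Finset.mem_filter, Finset.mem_Icc]
        exact ⟨fun h => ⟨⟨Nat.pos_of_dvd_of_pos h.1 hm, Nat.le_of_dvd hm h.1⟩, h.1⟩,
          fun h => ⟨h.2, by omega⟩⟩
      rw [hdiv, Finset.sum_filter]
      refine Finset.sum_congr rfl fun n hn => ?_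
      have hn0 : n ≠ 0 := Nat.one_le_iff_ne_zero.mp (Finset.mem_Icc.mp hn).1
      simp only [map_neg, map_sum, coeff_smul, coeff_formalLog_detSeries _ g hn0 hm, smul_eq_mul]
      split_ifs
      · rw [Finset.mul_sum, ← Finset.sum_neg_distrib]
        exact Finset.sum_congr rfl fun ρ _ => by ring
      · simp
    -- The sum is reindexed by $d=m/n$, which turns the weight $n/m$ into $1/d$.
    rw [key, ← Nat.sum_div_divisors]
    refine Eq.congr (Finset.sum_congr rfl fun d hd => ?_) rfl
    have hd' := Nat.dvd_of_mem_divisors hd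
    have hm0 : (m : ℂ) ≠ 0 := by exact_mod_cast (by omega : m ≠ 0)
    have hd0 : (d : ℂ) ≠ 0 := by exact_mod_cast (Nat.pos_of_mem_divisors hd).ne'
    rw [Nat.div_div_self hd' (by omega), Nat.cast_div hd' hd0]
    congr 1
    field_simp
  · intro n m hm
    have hn0 : n ≠ 0 := by omega
    rcases Nat.eq_zero_or_pos m with rfl | hm0
    · simp [constantCoeff_formalLog_detSeries _ g hn0]
    · simp [coeff_formalLog_detSeries _ g hn0 hm0, Nat.not_dvd_of_pos_of_lt hm0 hm]

end

/-! ### Divisor sums, the cyclotomic identity and the exponents. -/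

/-- Both sides run over factorizations $n=dkj$; the right side groups them by $l=dk$. -/
theorem sum_divisors_sum_divisors {M : Type*} [AddCommMonoid M] {n : ℕ} (hn : n ≠ 0)
    (F : ℕ → ℕ → ℕ → M) :
    ∑ d ∈ n.divisors, ∑ k ∈ (n / d).divisors, F d k (n / d / k) =
      ∑ l ∈ n.divisors, ∑ d ∈ l.divisors, F d (l / d) (n / l) := by
  rw [Finset.sum_sigma', Finset.sum_sigma']
  refine Finset.sum_bij' (fun x _ => ⟨x.1 * x.2, x.1⟩) (fun x _ => ⟨x.2, x.1 / x.2⟩) ?_ ?_ ?_ ?_ ?_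
  · rintro ⟨d, k⟩ h
    simp only [Finset.mem_sigma, Nat.mem_divisors] at h ⊢
    obtain ⟨⟨hd, -⟩, hk, hk0⟩ := h
    have h1 : d * k ∣ n := (Nat.dvd_div_iff_mul_dvd hd).mp hk
    exact ⟨⟨h1, hn⟩, dvd_mul_right _ _, ne_zero_of_dvd_ne_zero hn h1⟩
  · rintro ⟨l, d⟩ h
    simp only [Finset.mem_sigma, Nat.mem_divisors] at h ⊢
    obtain ⟨⟨hl, -⟩, hd, hl0⟩ := h
    have h1 : d ∣ n := hd.trans hl
    exact ⟨⟨h1, hn⟩, Nat.div_dvd_div hd hl,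
      (Nat.div_pos (Nat.le_of_dvd (Nat.pos_of_ne_zero hn) h1)
        (Nat.pos_of_dvd_of_pos h1 (Nat.pos_of_ne_zero hn))).ne'⟩
  · rintro ⟨d, k⟩ h
    simp only [Finset.mem_sigma] at h
    simp [Nat.mul_div_cancel_left _ (Nat.pos_of_mem_divisors h.1)]
  · rintro ⟨l, d⟩ h
    simp only [Finset.mem_sigma] at h
    simp [Nat.mul_div_cancel' (Nat.dvd_of_mem_divisors h.2)]
  · rintro ⟨d, k⟩ h
    simp only [Finset.mem_sigma] at h
    simp [Nat.mul_div_cancel_left _ (Nat.pos_of_mem_divisors h.1), Nat.div_div_eq_div_mul]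

theorem sum_divisors_moebius_div (t : ℕ) :
    ∑ d ∈ t.divisors, (ArithmeticFunction.moebius (t / d) : ℂ) = if t = 1 then 1 else 0 := by
  rw [Nat.sum_div_divisors t fun d => (ArithmeticFunction.moebius d : ℂ)]
  rw [← Int.cast_sum, ← ArithmeticFunction.coe_mul_zeta_apply,
    ArithmeticFunction.moebius_mul_coe_zeta, ArithmeticFunction.one_apply]
  push_cast
  rfl

section

variable {G : Type*} [Group G]

theorem character_cyclicTensorPow_mem {V : Type*} [AddCommGroup V] [Module ℂ V]
    [FiniteDimensional ℂ V] (ρ : Representation ℂ G V) {d : ℕ} (hd : d ≠ 0) (ζ : ℂ) :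
    ((cyclicTensorPow ρ d ζ).character : G → ℂ) ∈ integralVirtualChar G := by
  have : NeZero d := ⟨hd⟩
  have := finiteDimensional_piTensorProduct V d
  exact character_mem_integralVirtualChar _

theorem character_tensorPow_mem {V : Type*} [AddCommGroup V] [Module ℂ V]
    [FiniteDimensional ℂ V] (ρ : Representation ℂ G V) {d : ℕ} (hd : d ≠ 0) :
    ((tensorPow ρ d).character : G → ℂ) ∈ integralVirtualChar G := by
  have : NeZero d := ⟨hd⟩
  have := finiteDimensional_piTensorProduct V d
  exact character_mem_integralVirtualChar _

/-- The coefficient of `z^n` in `log Q` as a function on `G`. -/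
def logCoeff (Q : (G → ℂ)⟦X⟧) (n : ℕ) (g : G) : ℂ := coeff n (formalLog (evalAt Q g))

/-- Comparing coefficients in $(\log Q)'Q=Q'$ gives a recursion that uses only sums, scalar
multiples and products in $R(G)$. -/
theorem logCoeff_mem_virtualChar {Q : (G → ℂ)⟦X⟧} (hQ0 : constantCoeff Q = 1)
    (hQ : ∀ n : ℕ, 1 ≤ n → coeff n Q ∈ virtualChar G) {n : ℕ} (hn : 1 ≤ n) :
    logCoeff Q n ∈ virtualChar G := by
  induction n using Nat.strong_induction_on with
  | _ n ih =>
    obtain ⟨n, rfl⟩ := Nat.exists_eq_add_of_le' hn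
    have hrec : logCoeff Q (n + 1) = coeff (n + 1) Q - ∑ k ∈ Finset.range n,
        (((k : ℂ) + 1) / (n + 1)) • (logCoeff Q (k + 1) * coeff (n - k) Q) := by
      ext g
      have h := congrArg (coeff n) (derivative_formalLog_mul (constantCoeff_evalAt hQ0 g))
      rw [coeff_mul, Finset.Nat.sum_antidiagonal_eq_sum_range_succ_mk, Finset.sum_range_succ,
        Nat.sub_self, coeff_zero_eq_constantCoeff_apply, constantCoeff_evalAt hQ0] at h
      simp only [coeff_derivative, evalAt, coeff_map, Pi.evalRingHom_apply] at h
      have hn0 : (n : ℂ) + 1 ≠ 0 := by exact_mod_cast n.succ_ne_zero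
      simp only [Pi.sub_apply, Finset.sum_apply, Pi.smul_apply, Pi.mul_apply, smul_eq_mul, logCoeff,
        evalAt]
      rw [← mul_left_inj' hn0, sub_mul, ← h, Finset.sum_mul, mul_one, eq_sub_iff_add_eq']
      congr 1
      refine Finset.sum_congr rfl fun k _ => ?_
      field_simp
    rw [hrec]
    refine sub_mem (hQ _ hn) (Submodule.sum_mem _ fun k hk => Submodule.smul_mem _ _ ?_)
    have := Finset.mem_range.mp hk
    exact mul_mem_virtualChar (ih _ (by omega) (by omega)) (hQ _ (by omega))

variable [Fintype G]

theorem sum_divisors_character_cyclicTensorPow {V : Type*} [AddCommGroup V] [Module ℂ V]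
    [FiniteDimensional ℂ V] (ρ : Representation ℂ G V) {ζ : ℕ → ℂ}
    (hζ : ∀ d : ℕ, 1 ≤ d → IsPrimitiveRoot (ζ d) d) {l : ℕ} (hl : l ≠ 0) (g : G) :
    ∑ d ∈ l.divisors, (d : ℂ)⁻¹ * (cyclicTensorPow ρ (l / d) (ζ (l / d))).character (g ^ d) =
      (l : ℂ)⁻¹ * ρ.character g ^ l := by
  have h1 : ∀ d ∈ l.divisors,
      (d : ℂ)⁻¹ * (cyclicTensorPow ρ (l / d) (ζ (l / d))).character (g ^ d) =
        (l : ℂ)⁻¹ * ∑ e ∈ (l / d).divisors,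
          (ArithmeticFunction.moebius e : ℂ) * ρ.character (g ^ (d * e)) ^ (l / d / e) := by
    intro d hd
    have hdl := Nat.dvd_of_mem_divisors hd
    have hd0 : (d : ℂ) ≠ 0 := by exact_mod_cast (Nat.pos_of_mem_divisors hd).ne'
    have hpos : 0 < l / d := Nat.div_pos (Nat.divisor_le hd) (Nat.pos_of_mem_divisors hd)
    have : NeZero (l / d) := ⟨hpos.ne'⟩
    rw [character_cyclicTensorPow ρ (l / d) (hζ _ hpos), ← mul_assoc, ← mul_inv, ← Nat.cast_mul,
      Nat.mul_div_cancel' hdl]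
    simp only [pow_mul]
  rw [Finset.sum_congr rfl h1, ← Finset.mul_sum,
    sum_divisors_sum_divisors hl fun d e f =>
      (ArithmeticFunction.moebius e : ℂ) * ρ.character (g ^ (d * e)) ^ f]
  congr 1
  -- For fixed $t=de$ the character value depends only on $t$, so the Möbius sum removes every
  -- $t\neq1$.
  have h2 : ∀ t, ∑ d ∈ t.divisors,
      (ArithmeticFunction.moebius (t / d) : ℂ) * ρ.character (g ^ (d * (t / d))) ^ (l / t) =
        (if t = 1 then 1 else 0) * ρ.character (g ^ t) ^ (l / t) := by
    intro t
    rw [← sum_divisors_moebius_div t, Finset.sum_mul]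
    refine Finset.sum_congr rfl fun d hd => ?_
    rw [Nat.mul_div_cancel' (Nat.dvd_of_mem_divisors hd)]
  rw [Finset.sum_congr rfl fun t _ => h2 t,
    Finset.sum_eq_single_of_mem 1 (Nat.one_mem_divisors.mpr hl)]
  · simp
  · intro t _ ht
    simp [ht]

theorem eq_of_sum_mul_character_eq {a b : Irr G → ℂ}
    (h : ∀ g, ∑ ρ, a ρ * ρ.rep.character g = ∑ ρ, b ρ * ρ.rep.character g) : a = b := by
  have h' : ∑ ρ, a ρ • (ρ.rep.character : G → ℂ) = ∑ ρ, b ρ • (ρ.rep.character : G → ℂ) := by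
    ext g
    simpa using h g
  funext ρ
  rw [← charPairing_sum_smul a, h', charPairing_sum_smul]

theorem sum_character_eq_of_rSeq (q : ℕ → Irr G → ℂ) {n : ℕ} (hn : 1 ≤ n) (g : G) :
    ∑ ρ, q n ρ * ρ.rep.character g =
      ∑ d ∈ n.divisors, ∑ γ : Irr G, (d : ℂ)⁻¹ * γ.rep.character g ^ d * rSeq q (n / d) γ := by
  classical
  -- The recursion omits $d=1$; that term equals $r_{n,\rho}$ itself because
  -- $\langle\gamma^{\otimes1},\rho\rangle=\delta_{\gamma\rho}$.
  have h1 : ∀ ρ, q n ρ = ∑ d ∈ n.divisors, ∑ γ : Irr G,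
      charPairing (tensorPow γ.rep d).character ρ.rep.character / (d : ℂ) * rSeq q (n / d) γ := by
    intro ρ
    have h := rSeq_eq q n ρ
    have hf : n.divisors.filter (fun d => ¬ 1 < d) = {1} := by
      ext d
      simp only [Finset.mem_filter, Finset.mem_singleton]
      constructor
      · rintro ⟨h1, h2⟩
        have := Nat.pos_of_mem_divisors h1
        omega
      · rintro rfl
        exact ⟨Nat.one_mem_divisors.mpr (by omega), by omega⟩
    rw [← Finset.sum_filter_add_sum_filter_not _ (1 < ·), hf, Finset.sum_singleton,
      ← sub_eq_iff_eq_add', ← h]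
    have h2 : ∀ γ : Irr G, ((tensorPow γ.rep 1).character : G → ℂ) = γ.rep.character := by
      intro γ
      ext g
      rw [character_tensorPow, pow_one]
    simp [h2, Irr.charPairing_eq]
  simp_rw [h1, Finset.sum_mul]
  rw [Finset.sum_comm]
  refine Finset.sum_congr rfl fun d hd => ?_
  have hd0 := (Nat.pos_of_mem_divisors hd).ne'
  have : NeZero d := ⟨hd0⟩
  rw [Finset.sum_comm]
  refine Finset.sum_congr rfl fun γ _ => ?_
  rw [← character_tensorPow, ← congrFun (sum_charPairing_smul
    (mem_virtualChar_of_mem_integral (character_tensorPow_mem γ.rep hd0))) g, Finset.sum_apply,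
    Finset.mul_sum, Finset.sum_mul]
  refine Finset.sum_congr rfl fun ρ _ => ?_
  rw [Pi.smul_apply, smul_eq_mul]
  ring

/-- The exponents `b_{n,ρ} = ∑_{d ∣ n} ∑_γ ⟨γ^{⊗cyc d}, ρ⟩ r_{n/d,γ}`. -/
def cyclicExponent (ζ : ℕ → ℂ) (q : ℕ → Irr G → ℂ) (n : ℕ) (ρ : Irr G) : ℂ :=
  ∑ d ∈ n.divisors, ∑ γ : Irr G,
    charPairing (cyclicTensorPow γ.rep d (ζ d)).character ρ.rep.character * rSeq q (n / d) γ

theorem sum_cyclicExponent_mul_character (ζ : ℕ → ℂ) (q : ℕ → Irr G → ℂ) (n : ℕ) (g : G) :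
    ∑ ρ, cyclicExponent ζ q n ρ * ρ.rep.character g = ∑ d ∈ n.divisors, ∑ γ : Irr G,
      (cyclicTensorPow γ.rep d (ζ d)).character g * rSeq q (n / d) γ := by
  simp_rw [cyclicExponent, Finset.sum_mul]
  rw [Finset.sum_comm]
  refine Finset.sum_congr rfl fun d hd => ?_
  have hd0 := (Nat.pos_of_mem_divisors hd).ne'
  rw [Finset.sum_comm]
  refine Finset.sum_congr rfl fun γ _ => ?_
  conv_rhs => rw [← congrFun (sum_charPairing_smul
    (mem_virtualChar_of_mem_integral (character_cyclicTensorPow_mem γ.rep hd0 (ζ d)))) g]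
  rw [Finset.sum_apply, Finset.sum_mul]
  refine Finset.sum_congr rfl fun ρ _ => ?_
  rw [Pi.smul_apply, smul_eq_mul]
  ring

theorem sum_divisors_cyclicExponent {ζ : ℕ → ℂ} (hζ : ∀ d : ℕ, 1 ≤ d → IsPrimitiveRoot (ζ d) d)
    (q : ℕ → Irr G → ℂ) {n : ℕ} (hn : 1 ≤ n) (g : G) :
    ∑ d ∈ n.divisors, (d : ℂ)⁻¹ *
      ∑ ρ : Irr G, cyclicExponent ζ q (n / d) ρ * ρ.rep.character (g ^ d) =
        ∑ ρ, q n ρ * ρ.rep.character g := by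
  simp_rw [sum_cyclicExponent_mul_character, Finset.mul_sum]
  rw [sum_divisors_sum_divisors (by omega) fun d k j => ∑ γ : Irr G,
    (d : ℂ)⁻¹ * ((cyclicTensorPow γ.rep k (ζ k)).character (g ^ d) * rSeq q j γ),
    sum_character_eq_of_rSeq q hn]
  refine Finset.sum_congr rfl fun l hl => ?_
  rw [Finset.sum_comm]
  refine Finset.sum_congr rfl fun γ _ => ?_
  rw [← sum_divisors_character_cyclicTensorPow γ.rep hζ (Nat.pos_of_mem_divisors hl).ne',
    Finset.sum_mul]
  simp_rw [mul_assoc]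

/-- The terms with $d>1$ involve only smaller indices and cancel by induction. The term $d=1$ is
decided by independence of characters. -/
theorem exponent_unique {b b' : ℕ → Irr G → ℂ}
    (h : ∀ g : G, ∀ n : ℕ, 1 ≤ n →
      ∑ d ∈ n.divisors, (d : ℂ)⁻¹ * ∑ ρ : Irr G, b' (n / d) ρ * ρ.rep.character (g ^ d) =
      ∑ d ∈ n.divisors, (d : ℂ)⁻¹ * ∑ ρ : Irr G, b (n / d) ρ * ρ.rep.character (g ^ d))
    {n : ℕ} (hn : 1 ≤ n) : b' n = b n := by
  induction n using Nat.strong_induction_on with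
  | _ n ih =>
    refine eq_of_sum_mul_character_eq fun g => ?_
    have h1 := h g n hn
    have hmem : 1 ∈ n.divisors := Nat.one_mem_divisors.mpr (by omega)
    rw [← Finset.add_sum_erase _ _ hmem, ← Finset.add_sum_erase _ _ hmem] at h1
    have h2 : ∀ d ∈ n.divisors.erase 1, b' (n / d) = b (n / d) := by
      intro d hd
      obtain ⟨hd1, hd⟩ := Finset.mem_erase.mp hd
      have hpos := Nat.pos_of_mem_divisors hd
      exact ih _ (Nat.div_lt_self hn (by omega)) (Nat.div_pos (Nat.divisor_le hd) hpos)
    have h3 : ∑ d ∈ n.divisors.erase 1,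
        (d : ℂ)⁻¹ * ∑ ρ : Irr G, b' (n / d) ρ * ρ.rep.character (g ^ d) =
        ∑ d ∈ n.divisors.erase 1,
          (d : ℂ)⁻¹ * ∑ ρ : Irr G, b (n / d) ρ * ρ.rep.character (g ^ d) :=
      Finset.sum_congr rfl fun d hd => by rw [h2 d hd]
    rw [h3, add_left_inj] at h1
    simpa using h1

end

/-! ### Logarithmic derivatives over a general ring, where the logarithm may lack the needed
denominators. -/

section

variable {R S : Type*} [CommRing R] [CommRing S]

theorem map_derivative (f : R →+* S) (F : R⟦X⟧) :
    (d⁄dX R F).map f = d⁄dX S (F.map f) := by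
  ext n
  simp [coeff_derivative]

variable (R) in
/-- The logarithmic derivatives of power series with constant term `1`. -/
def logDerivs : AddSubgroup R⟦X⟧ where
  carrier := {L | ∃ F : R⟦X⟧, constantCoeff F = 1 ∧ L * F = d⁄dX R F}
  zero_mem' := ⟨1, by simp, by simp⟩
  add_mem' := by
    rintro L M ⟨F, hF, hL⟩ ⟨H, hH, hM⟩
    refine ⟨F * H, by simp [hF, hH], ?_⟩
    rw [Derivation.leibniz, smul_eq_mul, smul_eq_mul, ← hL, ← hM]
    ring
  neg_mem' := by
    rintro L ⟨F, hF, hL⟩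
    have hmul : F * invOfUnit F 1 = 1 := mul_invOfUnit F 1 (by simp [hF])
    refine ⟨invOfUnit F 1, by simp, ?_⟩
    have hd := congrArg (d⁄dX R) hmul
    rw [Derivation.leibniz, smul_eq_mul, smul_eq_mul, derivative_one, ← hL] at hd
    linear_combination (d⁄dX R (invOfUnit F 1) + L * invOfUnit F 1) * hmul - invOfUnit F 1 * hd

theorem exists_mem_logDerivs_mul_eq {F : R⟦X⟧} (hF : constantCoeff F = 1) :
    ∃ L ∈ logDerivs R, L * F = d⁄dX R F := by
  have hmul : invOfUnit F 1 * F = 1 := invOfUnit_mul F 1 (by simp [hF])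
  have h : d⁄dX R F * invOfUnit F 1 * F = d⁄dX R F := by rw [mul_assoc, hmul, mul_one]
  exact ⟨_, ⟨F, hF, h⟩, h⟩

theorem geomLogDeriv_mem_logDerivs (a : R) {n : ℕ} (hn : n ≠ 0) :
    geomLogDeriv a n ∈ logDerivs R := by
  rw [← neg_neg (geomLogDeriv a n)]
  exact neg_mem ⟨_, constantCoeff_one_sub_C_mul_X_pow a hn, neg_geomLogDeriv_mul a hn⟩

/-- In $LF=F'$ only the constant term of $F$ meets the lowest coefficient of $L$. The resulting
divisibility by $n+1$ is the source of integrality. -/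
theorem exists_coeff_eq_of_mem_logDerivs {L : R⟦X⟧} (hL : L ∈ logDerivs R) {n : ℕ}
    (h0 : ∀ k < n, coeff k L = 0) : ∃ a : R, coeff n L = (n + 1) * a := by
  obtain ⟨F, hF, h⟩ := hL
  refine ⟨coeff (n + 1) F, ?_⟩
  have h1 := congrArg (coeff n) h
  rw [coeff_mul, coeff_derivative, Finset.sum_eq_single (n, 0)] at h1
  · rw [mul_comm, ← h1]
    simp [hF]
  · rintro ⟨i, j⟩ hij hne
    rw [Finset.HasAntidiagonal.mem_antidiagonal] at hij
    rw [h0 i, zero_mul]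
    by_contra hi
    simp only at hij
    exact hne (Prod.ext (by simp only; omega) (by simp only; omega))
  · intro h
    simp at h

end

/-! ### Integrality of $r$ and $b$. -/

section

variable {G : Type*} [Group G]

/-- Evaluation of integral virtual characters at a group element. -/
def evalIntegral (g : G) : integralVirtualCharSubring G →+* ℂ :=
  (Pi.evalRingHom (fun _ : G => ℂ) g).comp (integralVirtualCharSubring G).subtype

/-- An irreducible character as an element of `R(G, ℤ)`. -/
def Irr.integralCharacter (ρ : Irr G) : integralVirtualCharSubring G :=
  ⟨ρ.rep.character, Submodule.subset_span ⟨ρ, rfl⟩⟩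

theorem exists_map_eq_evalAt {Q : (G → ℂ)⟦X⟧} (hQ0 : constantCoeff Q = 1)
    (hQ : ∀ n, 1 ≤ n → coeff n Q ∈ integralVirtualChar G) :
    ∃ F : (integralVirtualCharSubring G)⟦X⟧, constantCoeff F = 1 ∧
      ∀ g, F.map (evalIntegral g) = evalAt Q g := by
  have hmem : ∀ n, coeff n Q ∈ integralVirtualCharSubring G := by
    intro n
    rcases Nat.eq_zero_or_pos n with rfl | hn
    · rw [coeff_zero_eq_constantCoeff_apply, hQ0]
      exact one_mem _
    · exact hQ n hn
  refine ⟨PowerSeries.mk fun n => ⟨coeff n Q, hmem n⟩, ?_, fun g => ?_⟩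
  · rw [← coeff_zero_eq_constantCoeff_apply, coeff_mk]
    exact Subtype.ext ((coeff_zero_eq_constantCoeff_apply Q).trans hQ0)
  · ext n
    simp [evalAt, evalIntegral]

variable [Fintype G]

theorem rSeq_integral {Q : (G → ℂ)⟦X⟧} (hQ0 : constantCoeff Q = 1)
    (hQ : ∀ n, 1 ≤ n → coeff n Q ∈ integralVirtualChar G) {q : ℕ → Irr G → ℂ}
    (hq : ∀ g n, 1 ≤ n → ∑ ρ : Irr G, q n ρ * ρ.rep.character g = logCoeff Q n g) {n : ℕ}
    (hn : 1 ≤ n) (γ : Irr G) : ∃ k : ℤ, rSeq q n γ = k := by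
  induction n using Nat.strong_induction_on generalizing γ with
  | _ n ih =>
    obtain ⟨n, rfl⟩ := Nat.exists_eq_add_of_le' hn
    -- Placing the bounds inside the existential lets `choose` return a total function; the value
    -- $0$ out of range is never used.
    have hk : ∀ m γ, ∃ k : ℤ, 1 ≤ m → m < n + 1 → rSeq q m γ = k := by
      intro m γ
      by_cases h : 1 ≤ m ∧ m < n + 1
      · obtain ⟨k, hk⟩ := ih m h.2 h.1 γ
        exact ⟨k, fun _ _ => hk⟩
      · exact ⟨0, fun h1 h2 => (h ⟨h1, h2⟩).elim⟩
    choose k hk using hk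
    obtain ⟨F, hF, hFQ⟩ := exists_map_eq_evalAt hQ0 hQ
    obtain ⟨L, hLmem, hL⟩ := exists_mem_logDerivs_mul_eq hF
    -- For $m\mid N$ this is the coefficient of $z^{N-1}$ in the logarithmic derivative of
    -- $\prod_\gamma(1-\chi_\gamma(g)z^m)^{-r_{m,\gamma}}$.
    let T : G → ℕ → ℕ → ℂ := fun g N m =>
      m * ∑ γ : Irr G, rSeq q m γ * γ.rep.character g ^ (N / m)
    have hcoeffL : ∀ g j, coeff j (L.map (evalIntegral g)) =
        ∑ m ∈ (j + 1).divisors, T g (j + 1) m := by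
      intro g j
      have h1 : L.map (evalIntegral g) * evalAt Q g = d⁄dX ℂ (evalAt Q g) := by
        rw [← hFQ, ← map_mul, hL, map_derivative]
      rw [← coeff_formalLog_of_mul_eq (constantCoeff_evalAt hQ0 g) h1]
      have h2 := hq g (j + 1) (by omega)
      rw [logCoeff, sum_character_eq_of_rSeq q (by omega)] at h2
      rw [← h2, Finset.sum_mul, ← Nat.sum_div_divisors]
      refine Finset.sum_congr rfl fun d hd => ?_
      have hd' := Nat.dvd_of_mem_divisors hd
      have hd0 : (d : ℂ) ≠ 0 := by exact_mod_cast (Nat.pos_of_mem_divisors hd).ne'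
      simp only [T]
      rw [Nat.div_div_self hd' (by omega), Nat.cast_div hd' hd0, Finset.sum_mul, Finset.mul_sum]
      refine Finset.sum_congr rfl fun γ _ => ?_
      push_cast
      field_simp
    -- This is the logarithmic derivative of $Q\prod_{m\le n,\gamma}(1-\chi_\gamma
    -- z^m)^{r_{m,\gamma}}$, with integer exponents by induction.
    let M : (integralVirtualCharSubring G)⟦X⟧ :=
      L - ∑ m ∈ Finset.Icc 1 n, ∑ γ : Irr G, k m γ • geomLogDeriv γ.integralCharacter m
    have hM : M ∈ logDerivs (integralVirtualCharSubring G) :=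
      sub_mem hLmem (sum_mem fun m hm => sum_mem fun γ _ => zsmul_mem
        (geomLogDeriv_mem_logDerivs _ (Nat.one_le_iff_ne_zero.mp (Finset.mem_Icc.mp hm).1)) _)
    have hcoeffM : ∀ g j, evalIntegral g (coeff j M) =
        ∑ m ∈ (j + 1).divisors, T g (j + 1) m -
          ∑ m ∈ (Finset.Icc 1 n).filter (· ∣ j + 1), T g (j + 1) m := by
      intro g j
      rw [← hcoeffL, ← coeff_map, map_sub, map_sub]
      congr 1
      rw [coeff_map, map_sum, map_sum, Finset.sum_filter]
      refine Finset.sum_congr rfl fun m hm => ?_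
      obtain ⟨hm1, hm2⟩ := Finset.mem_Icc.mp hm
      simp only [map_sum, map_zsmul, geomLogDeriv, coeff_mk, T]
      split_ifs
      · rw [Finset.mul_sum]
        refine Finset.sum_congr rfl fun γ _ => ?_
        rw [hk m γ hm1 (by omega), map_mul, map_pow, map_natCast, zsmul_eq_mul]
        change (k m γ : ℂ) * (m * γ.rep.character g ^ _) = _
        ring
      · simp
    have hinj : ∀ x : integralVirtualCharSubring G, (∀ g, evalIntegral g x = 0) → x = 0 :=
      fun x hx => Subtype.ext (funext hx)
    -- For $j<n$ every divisor of $j+1$ is at most $n$, so the two sums cancel.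
    obtain ⟨a, ha⟩ := exists_coeff_eq_of_mem_logDerivs hM (n := n) (fun j hj => hinj _ fun g => by
      rw [hcoeffM, sub_eq_zero]
      refine Finset.sum_congr ?_ fun _ _ => rfl
      ext m
      simp only [Nat.mem_divisors, Finset.mem_filter, Finset.mem_Icc]
      constructor
      · rintro ⟨h, -⟩
        have h1 := Nat.le_of_dvd (by omega) h
        exact ⟨⟨Nat.pos_of_dvd_of_pos h (by omega), by omega⟩, h⟩
      · exact fun h => ⟨h.2, by omega⟩)
    -- In degree $n$ only the divisor $n+1$ survives, and its factor $n+1$ cancels the one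
    -- multiplying $a$.
    have hsum : ∑ γ : Irr G, rSeq q (n + 1) γ • (γ.rep.character : G → ℂ) = (a : G → ℂ) := by
      ext g
      have h1 := hcoeffM g n
      have hfilter : (Finset.Icc 1 n).filter (· ∣ n + 1) = (n + 1).properDivisors := by
        ext m
        simp only [Nat.mem_properDivisors, Finset.mem_filter, Finset.mem_Icc]
        constructor
        · exact fun h => ⟨h.2, by omega⟩
        · exact fun h => ⟨⟨Nat.pos_of_dvd_of_pos h.1 (by omega), by omega⟩, h.1⟩
      rw [hfilter, ← Nat.cons_self_properDivisors n.succ_ne_zero, Finset.sum_cons,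
        add_sub_cancel_right, ha] at h1
      have hn0 : (n : ℂ) + 1 ≠ 0 := by exact_mod_cast n.succ_ne_zero
      simp only [T, map_mul, map_add, map_natCast, map_one, Nat.div_self (Nat.succ_pos n),
        pow_one, Nat.cast_succ] at h1
      rw [Finset.sum_apply]
      exact (mul_left_cancel₀ hn0 h1).symm
    obtain ⟨c, hc⟩ := exists_int_charPairing (φ := (a : G → ℂ)) a.2 γ
    exact ⟨c, by rw [← hc, ← hsum, charPairing_sum_smul]⟩

theorem cyclicExponent_integral {q : ℕ → Irr G → ℂ} (ζ : ℕ → ℂ)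
    (hr : ∀ n γ, 1 ≤ n → ∃ k : ℤ, rSeq q n γ = k) (n : ℕ) (ρ : Irr G) :
    ∃ k : ℤ, cyclicExponent ζ q n ρ = k := by
  have : cyclicExponent ζ q n ρ ∈ (Int.castRingHom ℂ).range := by
    refine sum_mem fun d hd => sum_mem fun γ _ => mul_mem ?_ ?_
    · obtain ⟨k, hk⟩ := exists_int_charPairing (character_cyclicTensorPow_mem γ.rep
        (Nat.pos_of_mem_divisors hd).ne' (ζ d)) ρ
      exact ⟨k, hk.symm⟩
    · obtain ⟨k, hk⟩ := hr (n / d) γ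
        (Nat.div_pos (Nat.divisor_le hd) (Nat.pos_of_mem_divisors hd))
      exact ⟨k, hk.symm⟩
  obtain ⟨k, hk⟩ := this
  exact ⟨k, hk.symm⟩

end

/-! ### The theorem for a finite group and its Galois specialization. -/

theorem exists_traceExpansion_detExpansion {G : Type*} [Group G] [Fintype G]
    (ζ : ℕ → ℂ) (hζ : ∀ d : ℕ, 1 ≤ d → IsPrimitiveRoot (ζ d) d)
    (Q : (G → ℂ)⟦X⟧) (hQ0 : constantCoeff Q = 1)
    (hQ : ∀ n : ℕ, 1 ≤ n → coeff n Q ∈ virtualChar G) :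
    ∃ q b : ℕ → Irr G → ℂ,
      ((∀ g, TraceExpansionAt Q q g) ∧
        ∀ q', (∀ g, TraceExpansionAt Q q' g) → ∀ n, 1 ≤ n → q' n = q n) ∧
      ((∀ g, DetExpansionAt Q b g) ∧
        ∀ b', (∀ g, DetExpansionAt Q b' g) → ∀ n, 1 ≤ n → b' n = b n) ∧
      (∀ n, 1 ≤ n → ∀ ρ : Irr G, b n ρ = ∑ d ∈ n.divisors, ∑ γ : Irr G,
          charPairing (cyclicTensorPow γ.rep d (ζ d)).character ρ.rep.character *
            rSeq q (n / d) γ) ∧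
      ((∀ n, 1 ≤ n → coeff n Q ∈ integralVirtualChar G) →
        ∀ n, 1 ≤ n → ∀ ρ : Irr G, ∃ k : ℤ, b n ρ = k) := by
  let q : ℕ → Irr G → ℂ := fun n ρ => charPairing (logCoeff Q n) ρ.rep.character
  have hq : ∀ g n, 1 ≤ n → ∑ ρ : Irr G, q n ρ * ρ.rep.character g = logCoeff Q n g := by
    intro g n hn
    conv_rhs => rw [← sum_charPairing_smul (logCoeff_mem_virtualChar hQ0 hQ hn)]
    simp [q]
  have hb : ∀ g, DetExpansionAt Q (cyclicExponent ζ q) g := fun g =>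
    (detExpansionAt_iff hQ0 _ g).mpr fun n hn =>
      (sum_divisors_cyclicExponent hζ q hn g).trans (hq g n hn)
  refine ⟨q, cyclicExponent ζ q, ⟨fun g => (traceExpansionAt_iff hQ0 q g).mpr (hq g),
    fun q' hq' n hn => ?_⟩, ⟨hb, fun b' hb' n hn => ?_⟩, fun n _ ρ => rfl, fun hZ n _ ρ => ?_⟩
  · refine eq_of_sum_mul_character_eq fun g => ?_
    rw [hq g n hn]
    exact (traceExpansionAt_iff hQ0 q' g).mp (hq' g) n hn
  · refine exponent_unique (fun g m hm => ?_) hn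
    rw [(detExpansionAt_iff hQ0 _ g).mp (hb' g) m hm, (detExpansionAt_iff hQ0 _ g).mp (hb g) m hm]
  · exact cyclicExponent_integral ζ (fun m γ hm => rSeq_integral hQ0 hZ hq hm γ) n ρ

end FrobEuler

end

theorem mainTheorem6 (E : Type*) [Field E] [NumberField E]
    (ζ : ℕ → ℂ) (hζ : ∀ d : ℕ, 1 ≤ d → IsPrimitiveRoot (ζ d) d)
    (Q : (Gal(E/ℚ) → ℂ)⟦X⟧) (hQ0 : PowerSeries.constantCoeff Q = 1)
    (hQ : ∀ n : ℕ, 1 ≤ n → PowerSeries.coeff n Q ∈ FrobEuler.virtualChar Gal(E/ℚ)) :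
    ∃ q b : ℕ → FrobEuler.Irr Gal(E/ℚ) → ℂ,
      ((∀ g, FrobEuler.TraceExpansionAt Q q g) ∧
        ∀ q', (∀ g, FrobEuler.TraceExpansionAt Q q' g) → ∀ n, 1 ≤ n → q' n = q n) ∧
      ((∀ g, FrobEuler.DetExpansionAt Q b g) ∧
        ∀ b', (∀ g, FrobEuler.DetExpansionAt Q b' g) → ∀ n, 1 ≤ n → b' n = b n) ∧
      (∀ (p : ℕ) (σ : Gal(E/ℚ)), FrobEuler.IsFrobAtUnramified E p σ →
        FrobEuler.TraceExpansionAt Q q σ ∧ FrobEuler.DetExpansionAt Q b σ) ∧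
      (∀ n, 1 ≤ n → ∀ ρ : FrobEuler.Irr Gal(E/ℚ),
        b n ρ = ∑ d ∈ n.divisors, ∑ γ : FrobEuler.Irr Gal(E/ℚ),
          FrobEuler.charPairing (FrobEuler.cyclicTensorPow γ.rep d (ζ d)).character
            ρ.rep.character * FrobEuler.rSeq q (n / d) γ) ∧
      ((∀ n, 1 ≤ n → PowerSeries.coeff n Q ∈ FrobEuler.integralVirtualChar Gal(E/ℚ)) →
        ∀ n, 1 ≤ n → ∀ ρ : FrobEuler.Irr Gal(E/ℚ), ∃ k : ℤ, b n ρ = k) := by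
  obtain ⟨q, b, hq, hb, hformula, hint⟩ :=
    FrobEuler.exists_traceExpansion_detExpansion ζ hζ Q hQ0 hQ
  exact ⟨q, b, hq, hb, fun _ σ _ => ⟨hq.1 σ, hb.1 σ⟩, hformula, hint⟩
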